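/- **Notation.** Identify $\mathbb H^n$ with $\mathbb R^{4n}$ by $q_l=x_{4l}+\mathbf i x_{4l+1}+\mathbf j x_{4l+2}+\mathbf k x_{4l+3}$, let $\omega^0,\dots,\omega^{2n-1}$ be the standard basis of $\mathbb C^{2n}$, and put $$\begin{pmatrix}\nabla_{(2l)0}&\nabla_{(2l)1}\\ \nabla_{(2l+1)0}&\nabla_{(2l+1)1}\end{pmatrix}=\begin{pmatrix}\partial_{x_{4l}}+\mathbf i\partial_{x_{4l+1}}&-\partial_{x_{4l+2}}-\mathbf i\partial_{x_{4l+3}}\\ \partial_{x_{4l+2}}-\mathbf i\partial_{x_{4l+3}}&\partial_{x_{4l}}-\mathbf i\partial_{x_{4l+1}}\end{pmatrix},\qquad 0\le l<n.$$ For $F=\sum_I f_I\omega^I$ with values in $\wedge^k\mathbb C^{2n}$ let $d_\alpha F=\sum_{j,I}\nabla_{j\alpha}f_I\,\omega^j\wedge\omega^I$ ($\alpha=0,1$) and $\triangle F=d_0d_1F$; let $\beta_n=\sum_{l=0}^{n-1}\omega^{2l}\wedge\omega^{2l+1}$. For a right $\mathbb H$-linear map $\eta:\mathbb H^n\to\mathbb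 H$, $\eta(q)=\sum_l\eta_lq_l$, and $s=0,1$ let $\eta^*\widetilde\omega^s=\sum_{l}\sum_{t=0,1}\tau(\eta_l)_{st}\,\omega^{2l+t}$, where $\tau(a_0+\mathbf ia_1+\mathbf ja_2+\mathbf ka_3)=\begin{pmatrix}a_0-\mathbf ia_1&-a_2+\mathbf ia_3\\a_2+\mathbf ia_3&a_0+\mathbf ia_1\end{pmatrix}$. A $2k$-element is *strongly positive* if it is a finite combination with nonnegative coefficients of elements $\eta_1^*\widetilde\omega^0\wedge\eta_1^*\widetilde\omega^1\wedge\dots\wedge\eta_k^*\widetilde\omega^0\wedge\eta_k^*\widetilde\omega^1$ with $\eta_1,\dots,\eta_k$ linearly independent. Let $\Omega\subseteq\mathbb H^n$ be open. A *$(2n-k)$-current* on $\Omega$ is a continuous linear functional $T$ on the space of test $k$-forms $C_0^\infty(\Omega,\wedge^{k}\mathbb C^{2n})$. It is *closed* if $T(d_0\eta)=T(d_1\eta)=0$ for all test $(k-1)$-forms $\eta$; a $(2n-2p)$-current is *positive* if $T(\eta)\ge0$ for every test $2p$-form $\eta$ with strongly positive values. For a smooth $k$-form $\psi$ on an open set $U\subseteq\Omega$,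 $T\wedge\psi$ is the distribution $\varphi\mapsto T(\varphi\psi)$ on $U$; if it is given by a positive Radon measure $\mu$ on $U$, put $\int_B T\wedge\psi:=\mu(B)$ for Borel sets $B\subseteq U$. **Proposition.** Let $0\le p\le n$, $a\in\Omega$, $R>0$, $\overline{B(a,R)}\subseteq\Omega$, and let $T$ be a closed positive $(2n-2p)$-current on $\Omega$. Then $T\wedge\beta_n^p$ on $\Omega$ and $T\wedge\big(\triangle(-\|q-a\|^{-2})\big)^p$ on $\Omega\setminus\{a\}$ are given by positive Radon measures, and with $$\sigma_T(a,r):=\int_{B(a,r)}T\wedge\beta_n^p$$ one has, for all $0<r_1<r_2<R$, $$\int_{B(a,r_2)\setminus B(a,r_1)}T\wedge\big(\triangle(-\|q-a\|^{-2})\big)^p=8^p\left(\frac{\sigma_T(a,r_2)}{r_2^{4p}}-\frac{\sigma_T(a,r_1)}{r_1^{4p}}\right)$$ and $$\int_{B(a,r_2)\setminus\overline B(a,r_1)}T\wedge\big(\triangle(-\|q-a\|^{-2})\big)^p=8^p\left(\frac{\sigma_T(a,r_2)}{r_2^{4p}}-\frac{1}{r_1^{4p}}\int_{\overline B(a,r_1)}T\wedge\beta_n^p\right);$$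 in particular, the left side of the second formula is $8^p\big(\sigma_T(a,r_2)r_2^{-4p}-\sigma_T(a,r_1)r_1^{-4p}\big)$ whenever $T\wedge\beta_n^p$ has no mass on the sphere $\|q-a\|=r_1$. Hence $r\mapsto r^{-4p}\sigma_T(a,r)$ is nondecreasing on $(0,R)$, and the Lelong number $$\nu_a(T):=\lim_{r\to0+}\frac{\sigma_T(a,r)}{r^{4p}}$$ exists (as a real number) and is nonnegative. -/

import Mathlib

open Set Filter Topology MeasureTheory TopologicalSpace Metric
open scoped ContDiff Distributions Quaternion

noncomputable section

namespace QCurrent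

/-! ### The space `ℍⁿ ≅ ℝ⁴ⁿ` and the exterior algebra of `ℂ²ⁿ` -/

/-- `ℍⁿ ≅ ℝ⁴ⁿ` with the Euclidean norm; the coordinate `x (l, i)` is the real coordinate
`x_{4l+i}`, so that `q_l = x (l,0) + x (l,1) 𝐢 + x (l,2) 𝐣 + x (l,3) 𝐤`. -/
abbrev H (n : ℕ) : Type := EuclideanSpace ℝ (Fin n × Fin 4)

/-- The indices `0, …, 2n-1` of the basis `ω⁰, …, ω²ⁿ⁻¹` of `ℂ²ⁿ`; the pair `(l, s)` stands for
`2l+s`. -/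
abbrev Idx (n : ℕ) : Type := Fin n ×ₗ Fin 2

/-- The complex exterior algebra of `ℂ²ⁿ`; the product of this algebra is the wedge product. -/
def Lam (n : ℕ) : Type := ExteriorAlgebra ℂ (Idx n → ℂ)

instance instRingLam (n : ℕ) : Ring (Lam n) :=
  inferInstanceAs (Ring (ExteriorAlgebra ℂ (Idx n → ℂ)))

instance instAlgebraLam (n : ℕ) : Algebra ℂ (Lam n) :=
  inferInstanceAs (Algebra ℂ (ExteriorAlgebra ℂ (Idx n → ℂ)))

/-- The basis of the exterior algebra that consists of the products
`ω^I = ω^{i₁} ∧ … ∧ ω^{i_k}`, `i₁ < … < i_k`. -/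
def lamBasis (n : ℕ) : Module.Basis (Finset (Idx n)) ℂ (Lam n) :=
  (Pi.basisFun ℂ (Idx n)).ExteriorAlgebra

/-- The exterior algebra is normed by the largest modulus of a coefficient. -/
instance instNormedAddCommGroupLam (n : ℕ) : NormedAddCommGroup (Lam n) :=
  NormedAddCommGroup.induced (Lam n) (Finset (Idx n) → ℂ) (lamBasis n).equivFun
    (lamBasis n).equivFun.injective

instance instNormedSpaceLam (n : ℕ) : NormedSpace ℂ (Lam n) :=
  NormedSpace.induced ℂ (Lam n) (Finset (Idx n) → ℂ) (lamBasis n).equivFun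

instance instFiniteLam (n : ℕ) : FiniteDimensional ℂ (Lam n) :=
  Module.Basis.finiteDimensional_of_finite (lamBasis n)

/-- The basis vector `ω^j` of `ℂ²ⁿ`. -/
def om {n : ℕ} (j : Idx n) : Lam n :=
  ExteriorAlgebra.ι ℂ (Pi.single j (1 : ℂ) : Idx n → ℂ)

/-- `∧ᵏ ℂ²ⁿ`. -/
def deg (n k : ℕ) : Submodule ℂ (Lam n) :=
  (ExteriorAlgebra.exteriorPower ℂ k (Idx n → ℂ) :
    Submodule ℂ (ExteriorAlgebra ℂ (Idx n → ℂ)))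

/-- `β_n = ∑_l ω^{2l} ∧ ω^{2l+1}`. -/
def beta (n : ℕ) : Lam n :=
  ∑ l : Fin n, om (toLex (l, 0)) * om (toLex (l, 1))

/-! ### Strongly positive elements -/

/-- The embedding `τ : ℍ → ℂ^{2×2}`. -/
def tau (a : ℍ[ℝ]) : Matrix (Fin 2) (Fin 2) ℂ :=
  !![(a.re : ℂ) - Complex.I * a.imI, -(a.imJ : ℂ) + Complex.I * a.imK;
     (a.imJ : ℂ) + Complex.I * a.imK, (a.re : ℂ) + Complex.I * a.imI]

/-- For the right `ℍ`-linear map `η : ℍⁿ → ℍ`, `η(q) = ∑_l η_l q_l`, with row `(η_l)`, the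
pull-back `η^* ω̃^s = ∑_j τ(η)_{sj} ω^j` of the element `ω̃^s` of the standard basis of `ℂ²`. -/
def pullback {n : ℕ} (η : Fin n → ℍ[ℝ]) (s : Fin 2) : Lam n :=
  ∑ l : Fin n, ∑ t : Fin 2, tau (η l) s t • om (toLex (l, t))

/-- Elementary strongly positive `2k`-elements
`η_1^*ω̃⁰ ∧ η_1^*ω̃¹ ∧ … ∧ η_k^*ω̃⁰ ∧ η_k^*ω̃¹`, with `η_1, …, η_k` linearly independent right
`ℍ`-linear maps `ℍⁿ → ℍ` (which form a left `ℍ`-module). -/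
def IsElementary {n : ℕ} (k : ℕ) (ξ : Lam n) : Prop :=
  ∃ η : Fin k → Fin n → ℍ[ℝ], LinearIndependent ℍ[ℝ] η ∧
    ξ = (List.ofFn fun i : Fin k => pullback (η i) 0 * pullback (η i) 1).prod

/-- `SP^{2k} ℂ²ⁿ`, the convex cone generated by the elementary strongly positive `2k`-elements. -/
def SP (n k : ℕ) : Set (Lam n) :=
  {w | ∃ (m : ℕ) (c : Fin m → ℝ) (ξ : Fin m → Lam n),
    (∀ i, 0 ≤ c i) ∧ (∀ i, IsElementary k (ξ i)) ∧ w = ∑ i, (c i : ℂ) • ξ i}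

/-! ### The operators `d₀`, `d₁` and `△` -/

/-- The partial derivative `∂F/∂x_{4l+i}`. -/
def partialD {n : ℕ} (l : Fin n) (i : Fin 4) (F : H n → Lam n) (q : H n) : Lam n :=
  fderiv ℝ F q (EuclideanSpace.single (l, i) (1 : ℝ))

/-- The operator `∇_{jα}`, `j = 2l+s`. -/
def nabla {n : ℕ} (l : Fin n) (s α : Fin 2) (F : H n → Lam n) (q : H n) : Lam n :=
  !![partialD l 0 F q + Complex.I • partialD l 1 F q,
       -partialD l 2 F q - Complex.I • partialD l 3 F q;
     partialD l 2 F q - Complex.I • partialD l 3 F q,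
       partialD l 0 F q - Complex.I • partialD l 1 F q] s α

/-- `d_α F = ∑_j ω^j ∧ ∇_{jα} F`. -/
def d {n : ℕ} (α : Fin 2) (F : H n → Lam n) (q : H n) : Lam n :=
  ∑ l : Fin n, ∑ s : Fin 2, om (toLex (l, s)) * nabla l s α F q

/-- The Baston operator `△ u = d₀ d₁ u` on real functions. -/
def baston {n : ℕ} (u : H n → ℝ) : H n → Lam n :=
  d 0 (d 1 fun q => algebraMap ℂ (Lam n) (u q : ℂ))

/-! ### Smooth forms and test forms -/

/-- `ψ` is a smooth `k`-form on `U`. -/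
def IsSmoothForm {n : ℕ} (U : Set (H n)) (k : ℕ) (ψ : H n → Lam n) : Prop :=
  ContDiffOn ℝ ∞ ψ U ∧ ∀ q ∈ U, ψ q ∈ deg n k

/-- The test `k`-forms on `Ω`, i.e. `C_0^∞(Ω, ∧ᵏ ℂ²ⁿ)`. -/
abbrev TestForm {n : ℕ} (Ω : Opens (H n)) (k : ℕ) : Type := 𝓓(Ω, deg n k)

theorem exists_proj (n k : ℕ) :
    ∃ P : Lam n →L[ℝ] deg n k, ∀ w : deg n k, P (w : Lam n) = w := by
  obtain ⟨P, hP⟩ := LinearMap.exists_leftInverse_of_injective (deg n k).subtype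
    (Submodule.ker_subtype _)
  exact ⟨(LinearMap.toContinuousLinearMap P).restrictScalars ℝ,
    fun w => by simpa using LinearMap.congr_fun hP w⟩

theorem fderiv_mem_deg {n k : ℕ} {F : H n → Lam n} {q : H n}
    (hF : ∀ᶠ y in 𝓝 q, F y ∈ deg n k) (v : H n) : fderiv ℝ F q v ∈ deg n k := by
  by_cases hd : DifferentiableAt ℝ F q
  · obtain ⟨P, hP⟩ := exists_proj n k
    let J : deg n k →L[ℝ] Lam n := (deg n k).subtypeL.restrictScalars ℝ
    have h1 : F =ᶠ[𝓝 q] fun y => (J.comp P) (F y) := by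
      filter_upwards [hF] with y hy
      have := hP ⟨F y, hy⟩
      simp only at this
      simp [J, this]
    have h2 : fderiv ℝ F q = (J.comp P).comp (fderiv ℝ F q) := by
      conv_lhs => rw [h1.fderiv_eq]
      exact ((J.comp P).hasFDerivAt.comp q hd.hasFDerivAt).fderiv
    rw [h2]
    exact (P (fderiv ℝ F q v)).2
  · rw [fderiv_zero_of_not_differentiableAt hd]
    exact (deg n k).zero_mem

theorem om_mem {n : ℕ} (j : Idx n) : om j ∈ deg n 1 := by
  change ExteriorAlgebra.ι ℂ (Pi.single j (1 : ℂ) : Idx n → ℂ) ∈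
    (LinearMap.range (ExteriorAlgebra.ι ℂ : (Idx n → ℂ) →ₗ[ℂ] _)) ^ 1
  rw [pow_one]
  exact LinearMap.mem_range_self _ _

theorem mul_mem_deg {n i j : ℕ} {x y : Lam n} (hx : x ∈ deg n i) (hy : y ∈ deg n j) :
    x * y ∈ deg n (i + j) := by
  have h := Submodule.mul_mem_mul (M := ExteriorAlgebra.exteriorPower ℂ i (Idx n → ℂ))
    (N := ExteriorAlgebra.exteriorPower ℂ j (Idx n → ℂ)) hx hy
  rw [ExteriorAlgebra.exteriorPower, ExteriorAlgebra.exteriorPower, ← pow_add] at h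
  exact h

theorem pow_mem_deg {n i : ℕ} {x : Lam n} (hx : x ∈ deg n i) (p : ℕ) :
    x ^ p ∈ deg n (i * p) := by
  induction p with
  | zero =>
    rw [pow_zero]
    change (1 : ExteriorAlgebra ℂ (Idx n → ℂ)) ∈
      (LinearMap.range (ExteriorAlgebra.ι ℂ : (Idx n → ℂ) →ₗ[ℂ] _)) ^ 0
    rw [pow_zero]
    exact Submodule.one_le.1 le_rfl
  | succ p ih =>
    rw [pow_succ, Nat.mul_succ]
    exact mul_mem_deg ih hx

theorem algebraMap_mem_deg {n : ℕ} (c : ℂ) : algebraMap ℂ (Lam n) c ∈ deg n 0 := by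
  rw [Algebra.algebraMap_eq_smul_one]
  refine (deg n 0).smul_mem c ?_
  have := pow_mem_deg (n := n) (deg n 0).zero_mem 0
  simpa using this

theorem contDiffOn_mul {n : ℕ} {U : Set (H n)} {F G : H n → Lam n}
    (hF : ContDiffOn ℝ ∞ F U) (hG : ContDiffOn ℝ ∞ G U) :
    ContDiffOn ℝ ∞ (fun q => F q * G q) U := by
  let B₁ : Lam n →ₗ[ℂ] (Lam n →L[ℂ] Lam n) :=
    (LinearMap.toContinuousLinearMap : (Lam n →ₗ[ℂ] Lam n) ≃ₗ[ℂ] _).toLinearMap ∘ₗ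
      LinearMap.mul ℂ (Lam n)
  have hb : IsBoundedBilinearMap ℂ fun x : Lam n × Lam n => x.1 * x.2 :=
    (LinearMap.toContinuousLinearMap B₁).isBoundedBilinearMap
  have hc : ContDiff ℝ ∞ fun x : Lam n × Lam n => x.1 * x.2 :=
    (hb.contDiff (n := ∞)).restrict_scalars ℝ
  exact hc.comp_contDiffOn (hF.prodMk hG)

theorem contDiffOn_d {n : ℕ} {U : Set (H n)} (hU : IsOpen U) (α : Fin 2) {F : H n → Lam n}
    (hF : ContDiffOn ℝ ∞ F U) : ContDiffOn ℝ ∞ (d α F) U := by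
  have hp : ∀ (l : Fin n) (i : Fin 4), ContDiffOn ℝ ∞ (partialD l i F) U := fun l i =>
    (hF.fderiv_of_isOpen hU (by simp)).clm_apply contDiffOn_const
  have hI : ∀ G : H n → Lam n, ContDiffOn ℝ ∞ G U →
      ContDiffOn ℝ ∞ (fun q => Complex.I • G q) U := fun G hG => hG.const_smul Complex.I
  refine ContDiffOn.sum fun l _ => ContDiffOn.sum fun s _ => contDiffOn_mul contDiffOn_const ?_
  fin_cases s <;> fin_cases α
  · exact (hp l 0).add (hI _ (hp l 1))
  · exact (hp l 2).neg.sub (hI _ (hp l 3))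
  · exact (hp l 2).sub (hI _ (hp l 3))
  · exact (hp l 0).sub (hI _ (hp l 1))

theorem d_mem_deg {n k : ℕ} {F : H n → Lam n} {q : H n} (α : Fin 2)
    (hF : ∀ᶠ y in 𝓝 q, F y ∈ deg n k) : d α F q ∈ deg n (k + 1) := by
  have hp : ∀ (l : Fin n) (i : Fin 4), partialD l i F q ∈ deg n k := fun l i =>
    fderiv_mem_deg hF _
  have hI : ∀ x ∈ deg n k, Complex.I • x ∈ deg n k := fun x hx => (deg n k).smul_mem _ hx
  refine Submodule.sum_mem _ fun l _ => Submodule.sum_mem _ fun s _ => ?_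
  rw [add_comm k 1]
  refine mul_mem_deg (om_mem _) ?_
  fin_cases s <;> fin_cases α
  · exact (deg n k).add_mem (hp l 0) (hI _ (hp l 1))
  · exact (deg n k).sub_mem ((deg n k).neg_mem (hp l 2)) (hI _ (hp l 3))
  · exact (deg n k).sub_mem (hp l 2) (hI _ (hp l 3))
  · exact (deg n k).sub_mem (hp l 0) (hI _ (hp l 1))

theorem isSmoothForm_d {n k : ℕ} {U : Set (H n)} (hU : IsOpen U) (α : Fin 2) {F : H n → Lam n}
    (hF : IsSmoothForm U k F) : IsSmoothForm U (k + 1) (d α F) :=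
  ⟨contDiffOn_d hU α hF.1,
    fun _ hq => d_mem_deg α (Filter.eventually_of_mem (hU.mem_nhds hq) hF.2)⟩

theorem isSmoothForm_pow {n k : ℕ} {U : Set (H n)} {F : H n → Lam n}
    (hF : IsSmoothForm U k F) (p : ℕ) : IsSmoothForm U (k * p) (fun q => F q ^ p) := by
  refine ⟨?_, fun q hq => pow_mem_deg (hF.2 q hq) p⟩
  induction p with
  | zero => simpa using contDiffOn_const
  | succ p ih =>
    simp only [pow_succ]
    exact contDiffOn_mul ih hF.1

theorem isSmoothForm_beta_pow {n : ℕ} (U : Set (H n)) (p : ℕ) :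
    IsSmoothForm U (2 * p) (fun _ : H n => beta n ^ p) :=
  isSmoothForm_pow ⟨contDiffOn_const, fun _ _ => Submodule.sum_mem _ fun _ _ =>
    mul_mem_deg (om_mem _) (om_mem _)⟩ p

theorem isSmoothForm_baston_pow {n : ℕ} {U : Set (H n)} (hU : IsOpen U) {u : H n → ℝ}
    (hu : ContDiffOn ℝ ∞ u U) (p : ℕ) :
    IsSmoothForm U (2 * p) (fun q => baston u q ^ p) := by
  refine isSmoothForm_pow (isSmoothForm_d hU 0 (isSmoothForm_d hU 1 ⟨?_, ?_⟩)) p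
  · let A : ℂ →L[ℝ] Lam n :=
      (LinearMap.toContinuousLinearMap (Algebra.linearMap ℂ (Lam n))).restrictScalars ℝ
    exact (A.comp Complex.ofRealCLM).contDiff.comp_contDiffOn hu
  · exact fun q _ => algebraMap_mem_deg _

/-- A smooth compactly supported function with support in `Ω` and values in `∧ᵏ ℂ²ⁿ`, as a test
form. -/
def mkTestForm {n k : ℕ} {Ω : Opens (H n)} (F : H n → Lam n) (hs : ContDiff ℝ ∞ F)
    (hc : HasCompactSupport F) (hΩ : tsupport F ⊆ Ω) (hk : ∀ q, F q ∈ deg n k) :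
    TestForm Ω k where
  toFun q := ⟨F q, hk q⟩
  contDiff' := by
    obtain ⟨P, hP⟩ := exists_proj n k
    have : (fun q => (⟨F q, hk q⟩ : deg n k)) = fun q => P (F q) := by
      funext q
      exact (hP ⟨F q, hk q⟩).symm
    rw [this]
    exact P.contDiff.comp hs
  hasCompactSupport' := by
    refine hc.mono fun q hq => ?_
    intro h0
    exact hq (Subtype.ext h0)
  tsupport_subset' := by
    refine (closure_mono fun q hq => ?_).trans hΩ
    intro h0
    exact hq (Subtype.ext h0)

theorem contDiff_coe {n k : ℕ} {Ω : Opens (H n)} (η : TestForm Ω k) :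
    ContDiff ℝ ∞ fun q => (η q : Lam n) :=
  ((deg n k).subtypeL.restrictScalars ℝ).contDiff.comp η.contDiff

theorem tsupport_coe {n k : ℕ} {Ω : Opens (H n)} (η : TestForm Ω k) :
    tsupport (fun q => (η q : Lam n)) ⊆ tsupport η :=
  closure_mono fun _ hq h0 => hq (congrArg Subtype.val h0)

theorem tsupport_d {n : ℕ} (α : Fin 2) (F : H n → Lam n) : tsupport (d α F) ⊆ tsupport F := by
  refine closure_minimal (fun q hq => ?_) (isClosed_tsupport F)
  by_contra h
  have h0 : fderiv ℝ F q = 0 := by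
    by_contra h1
    exact h (support_fderiv_subset ℝ h1)
  refine hq (Finset.sum_eq_zero fun l _ => Finset.sum_eq_zero fun s _ => ?_)
  fin_cases s <;> fin_cases α <;> simp [nabla, partialD, h0]

/-- `d_α` on test forms. -/
def dTest {n j k : ℕ} {Ω : Opens (H n)} (α : Fin 2) (h : j + 1 = k) (η : TestForm Ω j) :
    TestForm Ω k :=
  mkTestForm (d α fun q => (η q : Lam n))
    (contDiffOn_univ.1 (contDiffOn_d isOpen_univ α (contDiff_coe η).contDiffOn))
    (η.hasCompactSupport.of_isClosed_subset (isClosed_tsupport _)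
      ((tsupport_d α _).trans (tsupport_coe η)))
    (((tsupport_d α _).trans (tsupport_coe η)).trans η.tsupport_subset)
    (fun _ => h ▸ d_mem_deg α (Filter.Eventually.of_forall fun y => (η y).2))

theorem contDiff_smul_form {n k : ℕ} {U : Opens (H n)} {ψ : H n → Lam n}
    (hψ : IsSmoothForm U k ψ) (φ : 𝓓(U, ℂ)) : ContDiff ℝ ∞ fun q => φ q • ψ q := by
  rw [contDiff_iff_contDiffAt]
  intro q
  by_cases hq : q ∈ tsupport φ
  · exact φ.contDiff.contDiffAt.smul
      (hψ.1.contDiffAt (U.isOpen.mem_nhds (φ.tsupport_subset hq)))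
  · have : (fun q => φ q • ψ q) =ᶠ[𝓝 q] fun _ => 0 := by
      filter_upwards [notMem_tsupport_iff_eventuallyEq.1 hq] with y hy
      rw [hy]
      exact zero_smul ℂ (ψ y)
    exact contDiffAt_const.congr_of_eventuallyEq this

theorem tsupport_smul_form {n : ℕ} {U : Opens (H n)} (ψ : H n → Lam n) (φ : 𝓓(U, ℂ)) :
    tsupport (fun q => φ q • ψ q) ⊆ tsupport φ :=
  closure_mono fun q hq h0 => hq (by
    show φ q • ψ q = 0
    rw [show φ q = 0 from h0]
    exact zero_smul ℂ (ψ q))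

/-- The test form `φ ψ` on `Ω`, for a test function `φ` on an open set `U ⊆ Ω` and a smooth form
`ψ` on `U`. -/
def smulForm {n k : ℕ} {U Ω : Opens (H n)} (hU : U ≤ Ω) {ψ : H n → Lam n}
    (hψ : IsSmoothForm U k ψ) (φ : 𝓓(U, ℂ)) : TestForm Ω k :=
  mkTestForm (fun q => φ q • ψ q) (contDiff_smul_form hψ φ)
    (φ.hasCompactSupport.of_isClosed_subset (isClosed_tsupport _) (tsupport_smul_form ψ φ))
    ((tsupport_smul_form ψ φ).trans (φ.tsupport_subset.trans hU))
    (fun q => by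
      by_cases hq : q ∈ (U : Set (H n))
      · exact (deg n k).smul_mem _ (hψ.2 q hq)
      · have h0 : φ q = 0 := by
          by_contra h
          exact hq (φ.tsupport_subset (subset_tsupport _ h))
        rw [h0, zero_smul]
        exact (deg n k).zero_mem)

/-! ### Currents -/

/-- The continuous dual of the space of test `k`-forms on `Ω`, that is, the space of
`(2n-k)`-currents on `Ω`. -/
abbrev Current {n : ℕ} (Ω : Opens (H n)) (k : ℕ) : Type := TestForm Ω k →L[ℂ] ℂ

/-- `T` is closed: `d₀ T = d₁ T = 0`, where `(d_α T)(η) = -T(d_α η)` for test `(k-1)`-forms `η`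
(there are none for `k = 0`). -/
def IsClosedCurrent {n k : ℕ} {Ω : Opens (H n)} (T : Current Ω k) : Prop :=
  ∀ (α : Fin 2) (j : ℕ) (h : j + 1 = k) (η : TestForm Ω j), -T (dTest α h η) = 0

/-- A `(2n-2p)`-current is positive if it is nonnegative on all strongly positive test
`2p`-forms. -/
def IsPositiveCurrent {n p : ℕ} {Ω : Opens (H n)} (T : Current Ω (2 * p)) : Prop :=
  ∀ η : TestForm Ω (2 * p), (∀ q, (η q : Lam n) ∈ SP n p) → 0 ≤ (T η).re ∧ (T η).im = 0

/-- The `2n`-current (distribution) `T ∧ ψ` on the open set `U ⊆ Ω`,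
`(T ∧ ψ)(φ) = T(φ ψ)`, for a `(2n-k)`-current `T` on `Ω` and a smooth `k`-form `ψ` on `U`. -/
def wedge {n k : ℕ} {Ω : Opens (H n)} (T : Current Ω k) {U : Opens (H n)} (hU : U ≤ Ω)
    {ψ : H n → Lam n} (hψ : IsSmoothForm U k ψ) (φ : 𝓓(U, ℂ)) : ℂ :=
  T (smulForm hU hψ φ)

/-- The `2n`-current `S` on `U` is `μ Ω_{2n}` for the positive Radon measure `μ` on `U` (regarded
as a Borel measure on `ℍⁿ` without mass outside `U`). -/
def IsMeasureOf {n : ℕ} {U : Opens (H n)} (S : 𝓓(U, ℂ) → ℂ) (μ : Measure (H n)) : Prop :=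
  μ (U : Set (H n))ᶜ = 0 ∧ (∀ K : Set (H n), IsCompact K → K ⊆ U → μ K < ⊤) ∧
    ∀ φ : 𝓓(U, ℂ), S φ = ∫ q, φ q ∂μ

open Classical in
/-- The measure of a `2n`-current that is given by a positive Radon measure (which is unique). -/
def measureOf {n : ℕ} {U : Opens (H n)} (S : 𝓓(U, ℂ) → ℂ) : Measure (H n) :=
  if h : ∃ μ, IsMeasureOf S μ then h.choose else 0

/-- `∫_B S := μ(B)` for a `2n`-current `S = μ Ω_{2n}`. -/
def integralOn {n : ℕ} {U : Opens (H n)} (S : 𝓓(U, ℂ) → ℂ) (B : Set (H n)) : ℝ :=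
  (measureOf S).real B

/-! ### The Lelong number -/

/-- The `2n`-current `T ∧ β_n^p`. -/
def wedgeBeta {n p : ℕ} {Ω : Opens (H n)} (T : Current Ω (2 * p)) : 𝓓(Ω, ℂ) → ℂ :=
  wedge T le_rfl (isSmoothForm_beta_pow (Ω : Set (H n)) p)

/-- `σ_T(a, r) = ∫_{B(a,r)} T ∧ β_n^p`. -/
def sigma {n p : ℕ} {Ω : Opens (H n)} (T : Current Ω (2 * p)) (a : H n) (r : ℝ) : ℝ :=
  integralOn (wedgeBeta T) (ball a r)

/-- `ν` is the Lelong number of `T` at `a`: `ν = lim_{r → 0+} σ_T(a, r) / r^{4p}`. -/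
def IsLelongNumber {n p : ℕ} {Ω : Opens (H n)} (T : Current Ω (2 * p)) (a : H n) (ν : ℝ) : Prop :=
  Tendsto (fun r : ℝ => sigma T a r / r ^ (4 * p)) (𝓝[>] 0) (𝓝 ν)

/-- `Ω ∖ {a}`. -/
def puncture {n : ℕ} (Ω : Opens (H n)) (a : H n) : Opens (H n) :=
  ⟨(Ω : Set (H n)) \ {a}, Ω.isOpen.sdiff isClosed_singleton⟩

theorem puncture_le {n : ℕ} (Ω : Opens (H n)) (a : H n) : puncture Ω a ≤ Ω :=
  fun _ hq => hq.1

/-- The function `-‖q - a‖⁻²`. -/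
def kernel {n : ℕ} (a q : H n) : ℝ := -(1 / ‖q - a‖ ^ 2)

theorem contDiffOn_kernel {n : ℕ} (Ω : Opens (H n)) (a : H n) :
    ContDiffOn ℝ ∞ (kernel a) (puncture Ω a : Set (H n)) := by
  have h : ContDiff ℝ ∞ fun q : H n => ‖q - a‖ ^ 2 :=
    (contDiff_id.sub contDiff_const).norm_sq ℝ
  refine (ContDiffOn.div contDiffOn_const h.contDiffOn fun q hq => ?_).neg
  exact pow_ne_zero _ (norm_ne_zero_iff.2 (sub_ne_zero.2 fun e => hq.2 e))

/-- The `2n`-current `T ∧ (△(-‖q - a‖⁻²))^p` on `Ω ∖ {a}`. -/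
def wedgeKernel {n p : ℕ} {Ω : Opens (H n)} (T : Current Ω (2 * p)) (a : H n) :
    𝓓(puncture Ω a, ℂ) → ℂ :=
  wedge T (puncture_le Ω a)
    (isSmoothForm_baston_pow (puncture Ω a).isOpen (contDiffOn_kernel Ω a) p)

end QCurrent

end

noncomputable section

namespace QCurrent

open scoped CompactlySupported

/-! ### Positive functionals on test functions are measures -/

section Measure

variable {n : ℕ} {U : Opens (H n)}

/-! Write t = ‖q - a‖², and let θ be the elementary 2-element of the row of conjugates of q - a. A
direct computation gives △(-1/t) = 8 t⁻³ (t β_n - θ) (`baston_kernel`). A quaternionic Lagrange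
identity writes t β_n - θ as a sum of elementary elements (`normSq_smul_beta_sub_theta_mem_SP`), and
powers stay in the strongly positive cones (`pow_mem_SP`). Hence T ∧ β_n^p and T ∧ (△(-1/t))^p are
positive functionals on test functions, and these are measures (`exists_isMeasureOf`).

Let p ≥ 1. Since θ² = 0 and θ commutes with β_n, the power (△(-1/t))^p involves only β_n^p and θ ∧
β_n^{p-1}. Closedness of T, tested on F(t) d₁t ∧ β_n^{p-1}, expresses T on F'(t) θ ∧ β_n^{p-1}
through T on F(t) β_n^p and so eliminates θ. The outcome (`wedgeKernel_radialTest`) is that T ∧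
(△(-1/t))^p on φ(t) equals 8^p times T ∧ β_n^p on G(t), where φ = t^{2p+1} F' / (2p) and G = F + t
F' / (2p). A given φ that vanishes near 0 and beyond r₂² determines F as the primitive of 2p φ /
t^{2p+1} vanishing at r₂². For p = 0 both sides are T itself.

Now let φ tend to the indicator function of [r₁², r₂²) or of (r₁², r₂²). Then G tends to r₂^{-4p} on
the ball of radius r₂, minus r₁^{-4p} on the open, respectively closed, ball of radius r₁
(`tendsto_radialDual`). Dominated convergence gives the two shell formulas (`measureReal_shell`).
Their left sides are masses, hence nonnegative, so r^{-4p} σ_T(a, r) is monotone; it is bounded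
below by 0, so its limit at 0 exists. -/

/-- A real test function, regarded as a complex one. -/
def realTest (U : Opens (H n)) : 𝓓(U, ℝ) →L[ℝ] 𝓓(U, ℂ) :=
  TestFunction.postcompCLM Complex.ofRealCLM

@[simp]
theorem realTest_apply (φ : 𝓓(U, ℝ)) (q : H n) : realTest U φ q = (φ q : ℂ) := by
  simp [realTest]

/-- Restriction of a real test function on `U` to the subtype `U`. -/
def restrictTest (U : Opens (H n)) : 𝓓(U, ℝ) →ₗ[ℝ] C_c(U, ℝ) where
  toFun φ :=
    { toFun := fun q => φ q
      continuous_toFun := φ.continuous.comp continuous_subtype_val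
      hasCompactSupport' := by
        have hK : IsCompact ((↑) ⁻¹' tsupport φ : Set U) :=
          IsInducing.subtypeVal.isCompact_preimage' φ.hasCompactSupport
            (by simpa using φ.tsupport_subset)
        refine hK.of_isClosed_subset (isClosed_tsupport _)
          (closure_minimal (fun q hq => ?_) ((isClosed_tsupport φ).preimage continuous_subtype_val))
        exact subset_tsupport φ hq }
  map_add' _ _ := rfl
  map_smul' _ _ := rfl

/-- This identifies test functions with a subspace of `C_c(U, ℝ)`, on which a functional can be
treated as a partially defined linear map. -/
theorem restrictTest_injective : Function.Injective (restrictTest U) := by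
  intro φ ψ h
  ext q
  by_cases hq : q ∈ U
  · exact DFunLike.congr_fun h (⟨q, hq⟩ : U)
  · have h0 : ∀ χ : 𝓓(U, ℝ), χ q = 0 := fun χ =>
      image_eq_zero_of_notMem_tsupport fun h' => hq (χ.tsupport_subset h')
    rw [h0, h0]

theorem exists_test_ge_one {K : Set (H n)} (hK : IsCompact K) (hKU : K ⊆ U) :
    ∃ χ : 𝓓(U, ℝ), (∀ q, 0 ≤ χ q) ∧ ∀ q ∈ K, χ q = 1 := by
  obtain ⟨L, hL, hKL, hLU⟩ := exists_compact_between hK U.isOpen hKU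
  obtain ⟨f, hf, hfL, hf1⟩ := exists_contMDiffMap_one_nhds_of_subset_interior
    (I := modelWithCornersSelf ℝ (H n)) (n := ⊤) hK.isClosed hKL
  have hsub : tsupport f ⊆ L := closure_minimal (fun q hq => by
    by_contra h
    exact hq (hfL q h)) hL.isClosed
  refine ⟨⟨f, f.contMDiff.contDiff, hL.of_isClosed_subset (isClosed_tsupport _) hsub,
    hsub.trans hLU⟩, fun q => (hf1 q).1, fun q hq => ?_⟩
  exact (hf.filter_mono (nhds_le_nhdsSet hq)).self_of_nhds

/-- Positivity replaces continuity. Test functions majorise every compactly supported continuous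
function, so M. Riesz's extension theorem extends the functional positively to `C_c(U, ℝ)`, where
the Riesz–Markov–Kakutani theorem applies. -/
theorem exists_isMeasureOf (S : 𝓓(U, ℂ) →ₗ[ℂ] ℂ)
    (hS : ∀ φ : 𝓓(U, ℝ), (∀ q, 0 ≤ φ q) → 0 ≤ (S (realTest U φ)).re ∧ (S (realTest U φ)).im = 0) :
    ∃ μ, IsMeasureOf S μ := by
  have hdom : ∀ (K : Set (H n)) (C : ℝ), IsCompact K → K ⊆ U → ∃ χ : 𝓓(U, ℝ), (∀ q, 0 ≤ χ q) ∧
      ∀ q ∈ K, C ≤ χ q := by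
    intro K C hK hKU
    obtain ⟨χ, h0, h1⟩ := exists_test_ge_one hK hKU
    refine ⟨|C| • χ, fun q => mul_nonneg (abs_nonneg C) (h0 q), fun q hq => ?_⟩
    change C ≤ |C| * χ q
    rw [h1 q hq, mul_one]
    exact le_abs_self C
  -- The hypothesis gives real values only on nonnegative functions; a general φ is the difference
  -- of φ + χ and χ, both nonnegative for a large cutoff χ.
  have him : ∀ φ : 𝓓(U, ℝ), (S (realTest U φ)).im = 0 := by
    intro φ
    obtain ⟨C, hC⟩ := φ.continuous.bounded_above_of_compact_support φ.hasCompactSupport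
    obtain ⟨χ, h0, h1⟩ := hdom _ C φ.hasCompactSupport φ.tsupport_subset
    have hpos : ∀ q, 0 ≤ (φ + χ) q := by
      intro q
      change 0 ≤ φ q + χ q
      by_cases hq : q ∈ tsupport φ
      · have := (abs_le.1 (hC q)).1
        linarith [h1 q hq]
      · rw [image_eq_zero_of_notMem_tsupport hq, zero_add]
        exact h0 q
    have e := (hS _ hpos).2
    rw [map_add, map_add, Complex.add_im, (hS χ h0).2, add_zero] at e
    exact e
  let Λ : 𝓓(U, ℝ) →ₗ[ℝ] ℝ := Complex.reLm ∘ₗ (S.restrictScalars ℝ) ∘ₗ (realTest U).toLinearMap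
  have hΛ : ∀ φ, Λ φ = (S (realTest U φ)).re := fun _ => rfl
  let e := LinearEquiv.ofInjective (restrictTest U) restrictTest_injective
  let f : C_c(U, ℝ) →ₗ.[ℝ] ℝ := ⟨LinearMap.range (restrictTest U), Λ ∘ₗ e.symm.toLinearMap⟩
  have hfe : ∀ φ : 𝓓(U, ℝ), f (e φ) = Λ φ := fun φ => by
    change Λ (e.symm (e φ)) = _
    rw [LinearEquiv.symm_apply_apply]
  let s : PointedCone ℝ C_c(U, ℝ) :=
    { carrier := {g | ∀ q, 0 ≤ g q}
      zero_mem' := fun q => le_rfl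
      smul_mem' := fun c g hg q => mul_nonneg c.2 (hg q)
      add_mem' := fun hg hg' q => add_nonneg (hg q) (hg' q) }
  -- The two side conditions are positivity on the subspace of test functions and the existence, for
  -- each y, of a test function whose sum with y is nonnegative.
  obtain ⟨g, hgf, hg⟩ := riesz_extension s f (by
      rintro ⟨_, φ, rfl⟩ hφ
      have : f (e φ) = Λ φ := hfe φ
      change 0 ≤ f (e φ)
      rw [this, hΛ]
      refine (hS φ fun q => ?_).1
      by_cases hq : q ∈ U
      · exact hφ ⟨q, hq⟩
      · rw [image_eq_zero_of_notMem_tsupport fun h' => hq (φ.tsupport_subset h')])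
    (by
      intro y
      obtain ⟨C, hC⟩ := y.continuous.bounded_above_of_compact_support y.hasCompactSupport
      obtain ⟨χ, h0, h1⟩ := hdom _ C (y.hasCompactSupport.isCompact.image continuous_subtype_val)
        (by rintro _ ⟨q, -, rfl⟩; exact q.2)
      refine ⟨e χ, fun q => ?_⟩
      change 0 ≤ χ q + y q
      by_cases hq : q ∈ tsupport y
      · have : -C ≤ y q := (abs_le.1 (hC q)).1
        linarith [h1 q ⟨q, hq, rfl⟩]
      · rw [image_eq_zero_of_notMem_tsupport hq, add_zero]
        exact h0 q)
  let Φ : C_c(U, ℝ) →ₚ[ℝ] ℝ := PositiveLinearMap.mk₀ g hg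
  have : LocallyCompactSpace U := U.isOpen.locallyCompactSpace
  let ν := RealRMK.rieszMeasure Φ
  have hemb : MeasurableEmbedding ((↑) : U → H n) :=
    MeasurableEmbedding.subtype_coe U.isOpen.measurableSet
  have hreal : ∀ φ : 𝓓(U, ℝ), ∫ q, φ q ∂(ν.map (↑)) = (S (realTest U φ)).re := by
    intro φ
    rw [hemb.integral_map]
    have h1 := RealRMK.integral_rieszMeasure Φ (restrictTest U φ)
    have h2 : g (e φ : C_c(U, ℝ)) = Λ φ := by rw [hgf, hfe]
    exact h1.trans h2
  have hfin : ∀ K : Set (H n), IsCompact K → K ⊆ U → ν.map (↑) K < ⊤ := by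
    intro K hK hKU
    rw [hemb.map_apply]
    obtain ⟨χ, h0, h1⟩ := exists_test_ge_one hK hKU
    have hK' : IsCompact ((↑) ⁻¹' K : Set U) :=
      IsInducing.subtypeVal.isCompact_preimage' hK (by simpa using hKU)
    exact (RealRMK.rieszMeasure_le_of_eq_one Φ (f := restrictTest U χ) (fun q => h0 q) hK'
      fun q hq => h1 q hq).trans_lt ENNReal.ofReal_lt_top
  refine ⟨ν.map (↑), ?_, hfin, fun φ => ?_⟩
  · rw [hemb.map_apply, preimage_compl, Subtype.coe_preimage_self, compl_univ, measure_empty]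
  · let φr : 𝓓(U, ℝ) := TestFunction.postcompCLM Complex.reCLM φ
    let φi : 𝓓(U, ℝ) := TestFunction.postcompCLM Complex.imCLM φ
    have hr : ∀ q, φr q = (φ q).re := fun q => by simp [φr]
    have hi : ∀ q, φi q = (φ q).im := fun q => by simp [φi]
    have hdec : φ = realTest U φr + Complex.I • realTest U φi := by
      ext q
      change φ q = realTest U φr q + Complex.I * realTest U φi q
      rw [realTest_apply, realTest_apply, hr, hi, mul_comm]
      exact (Complex.re_add_im _).symm
    have hint : Integrable φ (ν.map (↑)) := by
      have hon : IntegrableOn φ (tsupport φ) (ν.map (↑)) := by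
        obtain ⟨C, hC⟩ := φ.continuous.bounded_above_of_compact_support φ.hasCompactSupport
        exact Measure.integrableOn_of_bounded (hfin _ φ.hasCompactSupport φ.tsupport_subset).ne
          φ.continuous.aestronglyMeasurable (Eventually.of_forall hC)
      exact (integrableOn_iff_integrable_of_support_subset (subset_tsupport φ)).1 hon
    have hre : ∀ χ : 𝓓(U, ℝ), S (realTest U χ) = ((∫ q, χ q ∂(ν.map (↑)) : ℝ) : ℂ) := fun χ => by
      rw [hreal]
      exact Complex.ext rfl (by simp [him])
    rw [hdec, map_add, map_smul, hre, hre, ← hdec]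
    simp_rw [hr, hi]
    rw [← integral_re_add_im hint]
    simp [mul_comm]

end Measure

/-! ### The cone of strongly positive elements -/

section Algebra

variable {n : ℕ}

theorem mem_deg_one_iff {x : Lam n} :
    x ∈ deg n 1 ↔ ∃ w : Idx n → ℂ, (ExteriorAlgebra.ι ℂ w : ExteriorAlgebra ℂ (Idx n → ℂ)) = x := by
  change x ∈ (LinearMap.range (ExteriorAlgebra.ι ℂ : (Idx n → ℂ) →ₗ[ℂ] _)) ^ 1 ↔ _
  rw [pow_one]
  rfl

theorem mul_self_of_mem_deg_one {x : Lam n} (hx : x ∈ deg n 1) : x * x = 0 := by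
  obtain ⟨w, rfl⟩ := mem_deg_one_iff.1 hx
  exact ExteriorAlgebra.ι_sq_zero w

theorem mul_comm_of_mem_deg_one {x y : Lam n} (hx : x ∈ deg n 1) (hy : y ∈ deg n 1) :
    x * y = -(y * x) := by
  have h := mul_self_of_mem_deg_one ((deg n 1).add_mem hx hy)
  rw [mul_add, add_mul, add_mul, mul_self_of_mem_deg_one hx, mul_self_of_mem_deg_one hy,
    zero_add, add_zero] at h
  exact eq_neg_of_add_eq_zero_right h

/-- Moving z past two factors of degree one costs two signs, which cancel. -/
theorem commute_mul_of_mem_deg_one {x y z : Lam n} (hx : x ∈ deg n 1) (hy : y ∈ deg n 1)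
    (hz : z ∈ deg n 1) : Commute (x * y) z := by
  change x * y * z = z * (x * y)
  rw [mul_assoc, mul_comm_of_mem_deg_one hy hz, mul_neg, ← mul_assoc,
    mul_comm_of_mem_deg_one hx hz, neg_mul, neg_neg, mul_assoc]

/-- The part of a pull-back that comes from the coordinate `q_l`. -/
def pullbackAt (l : Fin n) (a : ℍ[ℝ]) (s : Fin 2) : Lam n :=
  ∑ t : Fin 2, tau a s t • om (toLex (l, t))

theorem pullback_eq_sum (η : Fin n → ℍ[ℝ]) (s : Fin 2) :
    pullback η s = ∑ l, pullbackAt l (η l) s := rfl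

theorem pullbackAt_mem (l : Fin n) (a : ℍ[ℝ]) (s : Fin 2) : pullbackAt l a s ∈ deg n 1 :=
  Submodule.sum_mem _ fun _ _ => (deg n 1).smul_mem _ (om_mem _)

theorem pullback_mem (η : Fin n → ℍ[ℝ]) (s : Fin 2) : pullback η s ∈ deg n 1 :=
  Submodule.sum_mem _ fun l _ => pullbackAt_mem l (η l) s

theorem tau_add (a b : ℍ[ℝ]) : tau (a + b) = tau a + tau b := by
  ext s t
  fin_cases s <;> fin_cases t <;> simp [tau] <;> ring

theorem tau_neg (a : ℍ[ℝ]) : tau (-a) = -tau a := by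
  ext s t
  fin_cases s <;> fin_cases t <;> simp [tau] <;> ring

theorem tau_zero : tau 0 = 0 := by
  ext s t
  fin_cases s <;> fin_cases t <;> simp [tau]

theorem tau_mul (a b : ℍ[ℝ]) : tau (a * b) = tau a * tau b := by
  ext s t
  fin_cases s <;> fin_cases t <;>
    simp [tau, Matrix.mul_apply, Fin.sum_univ_two, Complex.ext_iff] <;> constructor <;> ring

theorem pullbackAt_zero (l : Fin n) (s : Fin 2) : pullbackAt l 0 s = 0 := by
  simp [pullbackAt, tau_zero]

theorem pullbackAt_neg (l : Fin n) (a : ℍ[ℝ]) (s : Fin 2) :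
    pullbackAt l (-a) s = -pullbackAt l a s := by
  simp [pullbackAt, tau_neg]

theorem pullbackAt_add (l : Fin n) (a b : ℍ[ℝ]) (s : Fin 2) :
    pullbackAt l (a + b) s = pullbackAt l a s + pullbackAt l b s := by
  simp only [pullbackAt, tau_add, Matrix.add_apply, add_smul, Finset.sum_add_distrib]

theorem pullbackAt_mul (l : Fin n) (c a : ℍ[ℝ]) (s : Fin 2) :
    pullbackAt l (c * a) s = ∑ t, tau c s t • pullbackAt l a t := by
  simp only [pullbackAt, tau_mul, Matrix.mul_apply, Finset.smul_sum, Finset.sum_smul, smul_smul]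
  exact Finset.sum_comm

theorem pullback_zero (s : Fin 2) : pullback (0 : Fin n → ℍ[ℝ]) s = 0 := by
  simp [pullback_eq_sum, pullbackAt_zero]

theorem pullback_add (η ζ : Fin n → ℍ[ℝ]) (s : Fin 2) :
    pullback (η + ζ) s = pullback η s + pullback ζ s := by
  simp only [pullback_eq_sum, Pi.add_apply, pullbackAt_add, Finset.sum_add_distrib]

theorem pullback_smul (c : ℍ[ℝ]) (η : Fin n → ℍ[ℝ]) (s : Fin 2) :
    pullback (c • η) s = ∑ t, tau c s t • pullback η t := by
  simp only [pullback_eq_sum, Pi.smul_apply, smul_eq_mul, pullbackAt_mul, Finset.smul_sum]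
  exact Finset.sum_comm

theorem pullback_single (l : Fin n) (a : ℍ[ℝ]) (s : Fin 2) :
    pullback (Pi.single l a) s = pullbackAt l a s := by
  rw [pullback_eq_sum, Finset.sum_eq_single l]
  · rw [Pi.single_eq_same]
  · intro m _ hm
    rw [Pi.single_eq_of_ne hm, pullbackAt_zero]
  · simp

/-- The elementary `2`-element `η^*ω̃⁰ ∧ η^*ω̃¹`. -/
def theta (η : Fin n → ℍ[ℝ]) : Lam n := pullback η 0 * pullback η 1

theorem theta_mul_pullback_self (η : Fin n → ℍ[ℝ]) (s : Fin 2) : theta η * pullback η s = 0 := by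
  have h : ∀ s, pullback η s * pullback η s = 0 := fun s =>
    mul_self_of_mem_deg_one (pullback_mem η s)
  fin_cases s
  · change pullback η 0 * pullback η 1 * pullback η 0 = 0
    rw [mul_assoc, mul_comm_of_mem_deg_one (pullback_mem η 1) (pullback_mem η 0), mul_neg,
      ← mul_assoc, h, zero_mul, neg_zero]
  · change pullback η 0 * pullback η 1 * pullback η 1 = 0
    rw [mul_assoc, h, mul_zero]

theorem theta_mul_theta_self (η : Fin n → ℍ[ℝ]) : theta η * theta η = 0 := by
  rw [theta, ← mul_assoc, ← theta, theta_mul_pullback_self, zero_mul]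

theorem commute_theta {x : Lam n} (hx : x ∈ deg n 1) (η : Fin n → ℍ[ℝ]) : Commute (theta η) x :=
  commute_mul_of_mem_deg_one (pullback_mem η 0) (pullback_mem η 1) hx

theorem commute_theta_beta (η : Fin n → ℍ[ℝ]) : Commute (theta η) (beta n) :=
  Commute.sum_right _ _ _ fun _ _ =>
    (commute_theta (om_mem _) η).mul_right (commute_theta (om_mem _) η)

/-- The product of the elementary `2`-elements of `η_1, …, η_k`. -/
def thetaProd {k : ℕ} (η : Fin k → Fin n → ℍ[ℝ]) : Lam n :=
  (List.ofFn fun i : Fin k => pullback (η i) 0 * pullback (η i) 1).prod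

theorem thetaProd_succ {k : ℕ} (η : Fin (k + 1) → Fin n → ℍ[ℝ]) :
    thetaProd η = thetaProd (fun i : Fin k => η i.castSucc) * theta (η (Fin.last k)) := by
  rw [thetaProd, List.ofFn_succ', List.concat_eq_append, List.prod_append, List.prod_singleton]
  rfl

theorem thetaProd_snoc {k : ℕ} (η : Fin k → Fin n → ℍ[ℝ]) (ζ : Fin n → ℍ[ℝ]) :
    thetaProd (Fin.snoc η ζ : Fin (k + 1) → Fin n → ℍ[ℝ]) = thetaProd η * theta ζ := by
  rw [thetaProd_succ]
  simp

theorem thetaProd_mul_pullback {k : ℕ} (η : Fin k → Fin n → ℍ[ℝ]) (i : Fin k) (s : Fin 2) :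
    thetaProd η * pullback (η i) s = 0 := by
  induction k with
  | zero => exact i.elim0
  | succ k ih =>
    rw [thetaProd_succ, mul_assoc]
    refine Fin.lastCases ?_ (fun j => ?_) i
    · rw [theta_mul_pullback_self, mul_zero]
    · rw [(commute_theta (pullback_mem _ s) _).eq, ← mul_assoc, ih (fun i => η i.castSucc) j,
        zero_mul]

/-- The rows whose pull-backs are killed by a given product form a left ℍ-submodule, because the
pull-backs of c • η are combinations of those of η. It contains the rows of the product itself,
hence every row dependent on them. The independence condition in `IsElementary` thus excludes only
zero products. -/
theorem thetaProd_eq_zero {k : ℕ} (η : Fin k → Fin n → ℍ[ℝ])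
    (h : ¬LinearIndependent ℍ[ℝ] η) : thetaProd η = 0 := by
  induction k with
  | zero => exact absurd linearIndependent_empty_type h
  | succ k ih =>
    set v : Fin k → Fin n → ℍ[ℝ] := fun i => η i.castSucc
    have hη : η = Fin.snoc v (η (Fin.last k)) := (Fin.snoc_init_self η).symm
    rw [thetaProd_succ]
    by_cases hv : LinearIndependent ℍ[ℝ] v
    · have hmem : η (Fin.last k) ∈ Submodule.span ℍ[ℝ] (Set.range v) := by
        by_contra hn
        exact h (by rw [hη]; exact linearIndependent_finSnoc.2 ⟨hv, hn⟩)
      have key : ∀ s, thetaProd v * pullback (η (Fin.last k)) s = 0 := by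
        refine Submodule.span_induction (p := fun x _ => ∀ s, thetaProd v * pullback x s = 0)
          ?_ ?_ ?_ ?_ hmem
        · rintro _ ⟨i, rfl⟩ s
          exact thetaProd_mul_pullback v i s
        · intro s
          rw [pullback_zero, mul_zero]
        · intro x y _ _ hx hy s
          rw [pullback_add, mul_add, hx, hy, add_zero]
        · intro c x _ hx s
          rw [pullback_smul, Finset.mul_sum]
          exact Finset.sum_eq_zero fun t _ => by rw [mul_smul_comm, hx, smul_zero]
      rw [theta, ← mul_assoc, key, zero_mul]
    · rw [ih v hv, zero_mul]

/-! ### Closure of the strongly positive cones under sums and products. -/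

theorem zero_mem_SP (k : ℕ) : (0 : Lam n) ∈ SP n k :=
  ⟨0, Fin.elim0, Fin.elim0, fun i => i.elim0, fun i => i.elim0, by simp⟩

theorem add_mem_SP {k : ℕ} {x y : Lam n} (hx : x ∈ SP n k) (hy : y ∈ SP n k) :
    x + y ∈ SP n k := by
  obtain ⟨m, c, ξ, hc, hξ, rfl⟩ := hx
  obtain ⟨m', c', ξ', hc', hξ', rfl⟩ := hy
  refine ⟨m + m', Fin.append c c', Fin.append ξ ξ', fun i => ?_, fun i => ?_, ?_⟩
  · refine Fin.addCases (fun i => ?_) (fun i => ?_) i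
    · rw [Fin.append_left]; exact hc i
    · rw [Fin.append_right]; exact hc' i
  · refine Fin.addCases (fun i => ?_) (fun i => ?_) i
    · rw [Fin.append_left]; exact hξ i
    · rw [Fin.append_right]; exact hξ' i
  · simp [Fin.sum_univ_add]

theorem smul_mem_SP {k : ℕ} {x : Lam n} (hx : x ∈ SP n k) {r : ℝ} (hr : 0 ≤ r) :
    (r : ℂ) • x ∈ SP n k := by
  obtain ⟨m, c, ξ, hc, hξ, rfl⟩ := hx
  refine ⟨m, fun i => r * c i, ξ, fun i => mul_nonneg hr (hc i), hξ, ?_⟩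
  simp only [Finset.smul_sum, smul_smul, Complex.ofReal_mul]

theorem sum_mem_SP {k : ℕ} {ι : Type*} (s : Finset ι) {f : ι → Lam n}
    (h : ∀ i ∈ s, f i ∈ SP n k) : ∑ i ∈ s, f i ∈ SP n k :=
  Finset.sum_induction f (· ∈ SP n k) (fun _ _ => add_mem_SP) (zero_mem_SP k) h

theorem thetaProd_mem_SP {k : ℕ} (η : Fin k → Fin n → ℍ[ℝ]) : thetaProd η ∈ SP n k := by
  by_cases h : LinearIndependent ℍ[ℝ] η
  · exact ⟨1, fun _ => 1, fun _ => thetaProd η, fun _ => zero_le_one, fun _ => ⟨η, h, rfl⟩, by simp⟩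
  · rw [thetaProd_eq_zero η h]
    exact zero_mem_SP k

theorem theta_mem_SP (η : Fin n → ℍ[ℝ]) : theta η ∈ SP n 1 := by
  have h := thetaProd_mem_SP fun _ : Fin 1 => η
  rwa [thetaProd_succ, thetaProd, List.ofFn_zero, List.prod_nil, one_mul] at h

/-- Concatenating two independent families may give a dependent one; its product is then 0, which
still lies in the cone. -/
theorem mul_mem_SP {k : ℕ} {x y : Lam n} (hx : x ∈ SP n k) (hy : y ∈ SP n 1) :
    x * y ∈ SP n (k + 1) := by
  obtain ⟨m, c, ξ, hc, hξ, rfl⟩ := hx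
  obtain ⟨m', c', ξ', hc', hξ', rfl⟩ := hy
  rw [Finset.sum_mul_sum]
  refine sum_mem_SP _ fun i _ => sum_mem_SP _ fun j _ => ?_
  rw [smul_mul_smul_comm, ← Complex.ofReal_mul]
  refine smul_mem_SP ?_ (mul_nonneg (hc i) (hc' j))
  obtain ⟨η, -, hη⟩ := hξ i
  obtain ⟨ζ, -, hζ⟩ := hξ' j
  have e : ξ i * ξ' j = thetaProd (Fin.snoc η (ζ 0) : Fin (k + 1) → Fin n → ℍ[ℝ]) := by
    rw [thetaProd_snoc, hη, hζ]
    simp [thetaProd, theta]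
  rw [e]
  exact thetaProd_mem_SP _

theorem pow_mem_SP {x : Lam n} (hx : x ∈ SP n 1) (p : ℕ) : x ^ p ∈ SP n p := by
  induction p with
  | zero =>
    have h := thetaProd_mem_SP (n := n) (Fin.elim0 : Fin 0 → Fin n → ℍ[ℝ])
    rwa [thetaProd, List.ofFn_zero, List.prod_nil, ← pow_zero x] at h
  | succ p ih =>
    rw [pow_succ]
    exact mul_mem_SP ih hx

/-- The coefficient is det τ(a) = |a|². -/
theorem pullbackAt_zero_mul_one (l : Fin n) (a : ℍ[ℝ]) :
    pullbackAt l a 0 * pullbackAt l a 1 =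
      ((Quaternion.normSq a : ℝ) : ℂ) • (om (toLex (l, 0)) * om (toLex (l, 1))) := by
  have h0 : ∀ t : Fin 2, om (toLex (l, t)) * om (toLex (l, t)) = 0 := fun t =>
    mul_self_of_mem_deg_one (om_mem _)
  have h1 : om (toLex (l, 1)) * om (toLex (l, 0)) = -(om (toLex (l, 0)) * om (toLex (l, 1))) :=
    mul_comm_of_mem_deg_one (om_mem _) (om_mem _)
  simp only [pullbackAt, Fin.sum_univ_two, mul_add, add_mul, smul_mul_smul_comm, h0, h1, smul_zero,
    smul_neg, zero_add, add_zero, ← neg_smul, ← add_smul]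
  congr 1
  simp [tau, Quaternion.normSq_def', Complex.ext_iff, sq]
  constructor <;> ring

/-! ### The quaternionic Lagrange identity. -/

/-- The mixed terms of `theta` that belong to the coordinates `q_l` and `q_m`. -/
def thetaMixed (l m : Fin n) (a b : ℍ[ℝ]) : Lam n :=
  pullbackAt l a 0 * pullbackAt m b 1 + pullbackAt m b 0 * pullbackAt l a 1

/-- With J the matrix on the right, the left side is the entry of τ(a)ᵀ J τ(b), and τ(a)ᵀ J = J
τ(ā). Mixed terms therefore depend on a and b only through ā b. -/
theorem tau_minor (a b : ℍ[ℝ]) (t t' : Fin 2) :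
    tau a 0 t * tau b 1 t' - tau a 1 t * tau b 0 t' =
      (!![0, 1; -1, 0] * tau (star a * b) : Matrix (Fin 2) (Fin 2) ℂ) t t' := by
  fin_cases t <;> fin_cases t' <;>
    simp [tau, Matrix.mul_apply, Fin.sum_univ_two, Complex.ext_iff] <;> constructor <;> ring

theorem thetaMixed_eq (l m : Fin n) (a b : ℍ[ℝ]) :
    thetaMixed l m a b = ∑ t, ∑ t', (!![0, 1; -1, 0] * tau (star a * b) :
      Matrix (Fin 2) (Fin 2) ℂ) t t' • (om (toLex (l, t)) * om (toLex (m, t'))) := by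
  rw [thetaMixed, mul_comm_of_mem_deg_one (pullbackAt_mem m b 0) (pullbackAt_mem l a 1),
    ← sub_eq_add_neg]
  simp only [← tau_minor, pullbackAt, Finset.sum_mul_sum, smul_mul_smul_comm, sub_smul,
    Finset.sum_sub_distrib]

theorem thetaMixed_neg (l m : Fin n) (a b : ℍ[ℝ]) :
    thetaMixed l m a (-b) = -thetaMixed l m a b := by
  simp only [thetaMixed, pullbackAt_neg]
  noncomm_ring

theorem theta_single_add_single (l m : Fin n) (a b : ℍ[ℝ]) :
    theta (Pi.single l a + Pi.single m b) =
      ((Quaternion.normSq a : ℝ) : ℂ) • (om (toLex (l, 0)) * om (toLex (l, 1))) +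
      ((Quaternion.normSq b : ℝ) : ℂ) • (om (toLex (m, 0)) * om (toLex (m, 1))) +
      thetaMixed l m a b := by
  simp only [theta, pullback_add, pullback_single, ← pullbackAt_zero_mul_one, thetaMixed]
  noncomm_ring

theorem two_smul_theta (v : Fin n → ℍ[ℝ]) :
    (2 : ℂ) • theta v = ∑ l, ∑ m, thetaMixed l m (v l) (v m) := by
  simp only [thetaMixed, Finset.sum_add_distrib]
  rw [Finset.sum_comm (f := fun l m => pullbackAt m (v m) 0 * pullbackAt l (v l) 1), two_smul,
    ← Finset.sum_mul_sum]
  rfl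

/-- The norms of a and b are exchanged while ā b, hence the mixed term, is kept. For a ≠ 0 one
normalises B to the real number |a|, which forces A = b̄ a / |a|. -/
theorem exists_swap_normSq (a b : ℍ[ℝ]) : ∃ A B : ℍ[ℝ],
    Quaternion.normSq A = Quaternion.normSq b ∧ Quaternion.normSq B = Quaternion.normSq a ∧
      star A * B = star a * b := by
  by_cases ha : a = 0
  · exact ⟨b, 0, rfl, by rw [ha], by simp [ha]⟩
  · have h0 : ‖a‖ ≠ 0 := norm_ne_zero_iff.2 ha
    refine ⟨(‖a‖⁻¹ : ℝ) • (star b * a), ((‖a‖ : ℝ) : ℍ[ℝ]), ?_, ?_, ?_⟩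
    · rw [Quaternion.normSq_smul, map_mul, Quaternion.normSq_star,
        Quaternion.normSq_eq_norm_mul_self a]
      field_simp
    · rw [Quaternion.normSq_coe, Quaternion.normSq_eq_norm_mul_self a, sq]
    · rw [Quaternion.star_smul, star_mul, star_star, smul_mul_assoc, ← Quaternion.coe_commutes,
        Quaternion.coe_mul_eq_smul, smul_smul, inv_mul_cancel₀ h0, one_smul]

/-- Lagrange's identity: `|v|² β_n - v^*ω̃⁰ ∧ v^*ω̃¹` is strongly positive. -/
theorem normSq_smul_beta_sub_theta_mem_SP (v : Fin n → ℍ[ℝ]) :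
    ((∑ l, Quaternion.normSq (v l) : ℝ) : ℂ) • beta n - theta v ∈ SP n 1 := by
  set b : Fin n → Lam n := fun l => om (toLex (l, 0)) * om (toLex (l, 1)) with hb
  set N : Fin n → ℂ := fun l => ((Quaternion.normSq (v l) : ℝ) : ℂ) with hN
  -- Symmetrising over pairs (l, m) counts everything twice, whence the factor 1/2.
  have hsum : ((∑ l, Quaternion.normSq (v l) : ℝ) : ℂ) • beta n - theta v =
      ((1 / 2 : ℝ) : ℂ) • ∑ l, ∑ m, (N m • b l + N l • b m - thetaMixed l m (v l) (v m)) := by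
    have e1 : ∑ l, ∑ m, N m • b l = ((∑ l, Quaternion.normSq (v l) : ℝ) : ℂ) • beta n := by
      simp only [hN, hb, beta, ← Finset.sum_smul, ← Finset.smul_sum, Complex.ofReal_sum]
    have e2 : ∑ l, ∑ m, N l • b m = ((∑ l, Quaternion.normSq (v l) : ℝ) : ℂ) • beta n := by
      rw [Finset.sum_comm, e1]
    simp only [Finset.sum_sub_distrib, Finset.sum_add_distrib]
    rw [e1, e2, ← two_smul_theta, ← two_smul ℂ, ← smul_sub, smul_smul]
    norm_num
  rw [hsum]
  refine smul_mem_SP (sum_mem_SP _ fun l _ => sum_mem_SP _ fun m _ => ?_) (by norm_num)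
  by_cases hlm : l = m
  · subst hlm
    have : N l • b l + N l • b l - thetaMixed l l (v l) (v l) = 0 := by
      simp only [thetaMixed, pullbackAt_zero_mul_one, hN, hb, sub_self]
    rw [this]
    exact zero_mem_SP 1
  -- In the (l, m) term |v_m|² stands at l and |v_l|² at m. Swapping the norms makes it the
  -- elementary element of a row supported on l and m, with the sign of the mixed term absorbed in
  -- -B.
  · obtain ⟨A, B, hA, hB, hAB⟩ := exists_swap_normSq (v l) (v m)
    have : N m • b l + N l • b m - thetaMixed l m (v l) (v m) =
        theta (Pi.single l A + Pi.single m (-B)) := by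
      rw [theta_single_add_single, thetaMixed_neg, Quaternion.normSq_neg, hA, hB,
        thetaMixed_eq l m A B, hAB, ← thetaMixed_eq, sub_eq_add_neg]
    rw [this]
    exact theta_mem_SP _

theorem beta_mem_SP : beta n ∈ SP n 1 := by
  refine sum_mem_SP _ fun l _ => ?_
  have h := theta_mem_SP (Pi.single l (1 : ℍ[ℝ]))
  rw [theta, pullback_single, pullback_single, pullbackAt_zero_mul_one] at h
  simpa using h

end Algebra

/-! ### Derivatives of radial forms -/

section Calculus

variable {n : ℕ}

/-- The row of the right linear form `q ↦ ∑_l v̄_l q_l`. -/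
def conjRow (v : H n) : Fin n → ℍ[ℝ] :=
  fun l => ⟨v (l, 0), -v (l, 1), -v (l, 2), -v (l, 3)⟩

@[simp]
theorem conjRow_re (v : H n) (l : Fin n) : (conjRow v l).re = v (l, 0) := rfl

@[simp]
theorem conjRow_imI (v : H n) (l : Fin n) : (conjRow v l).imI = -v (l, 1) := rfl

@[simp]
theorem conjRow_imJ (v : H n) (l : Fin n) : (conjRow v l).imJ = -v (l, 2) := rfl

@[simp]
theorem conjRow_imK (v : H n) (l : Fin n) : (conjRow v l).imK = -v (l, 3) := rfl

theorem sum_normSq_conjRow (v : H n) : ∑ l, Quaternion.normSq (conjRow v l) = ‖v‖ ^ 2 := by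
  rw [EuclideanSpace.norm_sq_eq, Fintype.sum_prod_type]
  refine Finset.sum_congr rfl fun l _ => ?_
  rw [Quaternion.normSq_def', Fin.sum_univ_four]
  simp

theorem tau_smul (c : ℝ) (a : ℍ[ℝ]) : tau (c • a) = (c : ℂ) • tau a := by
  ext s t
  fin_cases s <;> fin_cases t <;> simp [tau] <;> ring

theorem pullbackAt_smul (l : Fin n) (c : ℝ) (a : ℍ[ℝ]) (s : Fin 2) :
    pullbackAt l (c • a) s = (c : ℂ) • pullbackAt l a s := by
  simp only [pullbackAt, tau_smul, Matrix.smul_apply, smul_eq_mul, Finset.smul_sum, smul_smul]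

/-- The pull-back of `ω̃^s` by `q ↦ ∑_l v̄_l q_l`, as a real-linear function of `v`. -/
def conjPullback (s : Fin 2) : H n →ₗ[ℝ] Lam n where
  toFun v := pullback (conjRow v) s
  map_add' v w := by
    have h : conjRow (v + w) = conjRow v + conjRow w := by
      funext l
      ext <;> simp <;> ring
    rw [h, pullback_add]
  map_smul' c v := by
    have h : ∀ l, conjRow (c • v) l = c • conjRow v l := fun l => by
      ext <;> simp
    simp only [pullback_eq_sum, h, pullbackAt_smul, RingHom.id_apply, ← Finset.smul_sum,
      Complex.coe_smul]

theorem conjPullback_apply (s : Fin 2) (v : H n) : conjPullback s v = pullback (conjRow v) s := rfl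

theorem conjPullback_mem (s : Fin 2) (v : H n) : conjPullback s v ∈ deg n 1 := pullback_mem _ _

/-- The coefficient `∇_{sα}` of the gradient `w` in the variables of one quaternion. -/
def symb (s α : Fin 2) (w : Fin 4 → Lam n) : Lam n :=
  !![w 0 + Complex.I • w 1, -w 2 - Complex.I • w 3;
     w 2 - Complex.I • w 3, w 0 - Complex.I • w 1] s α

theorem d_eq_symb (α : Fin 2) (F : H n → Lam n) (q : H n) :
    d α F q = ∑ l : Fin n, ∑ s : Fin 2, om (toLex (l, s)) *
      symb s α fun i => fderiv ℝ F q (EuclideanSpace.single (l, i) (1 : ℝ)) := rfl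

theorem d_congr {α : Fin 2} {F G : H n → Lam n} {q : H n} (h : F =ᶠ[𝓝 q] G) :
    d α F q = d α G q := by
  rw [d_eq_symb, d_eq_symb, h.fderiv_eq]

/-- The matrix of the symbols ∇_{sα} at the real vector v_l is the transpose of τ(v̄_l); this is why
conjugate rows appear. -/
theorem sum_om_mul_symb (α : Fin 2) (l : Fin n) (v : H n) (A B : ℂ) (w : Fin 4 → Lam n)
    (x : Lam n) :
    ∑ s : Fin 2, om (toLex (l, s)) * symb s α (fun i => A • w i + (B * (v (l, i) : ℝ)) • x) =
      B • (pullbackAt l (conjRow v l) α * x) + A • ∑ s : Fin 2, om (toLex (l, s)) * symb s α w := by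
  fin_cases α <;>
  · simp [Fin.sum_univ_two, symb, pullbackAt, tau, mul_add, mul_sub, add_mul]
    module

/-- Product and chain rule, with d_α‖q - a‖² = 2 `conjPullback α (q - a)`. -/
theorem d_radial_smul {g : ℝ → ℝ} {g' : ℝ} {a q : H n} {G : H n → Lam n} (α : Fin 2)
    (hg : HasDerivAt g g' (‖q - a‖ ^ 2)) (hG : DifferentiableAt ℝ G q) :
    d α (fun y => ((g (‖y - a‖ ^ 2) : ℝ) : ℂ) • G y) q =
      (2 * g' : ℂ) • (conjPullback α (q - a) * G q) +
        ((g (‖q - a‖ ^ 2) : ℝ) : ℂ) • d α G q := by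
  have hu : HasFDerivAt (fun y : H n => ‖y - a‖ ^ 2) (2 • (innerSL ℝ (q - a))) q := by
    simpa using ((hasFDerivAt_id q).sub_const a).norm_sq
  have hf := hg.comp_hasFDerivAt q hu
  have hF := hf.smul hG.hasFDerivAt
  have key : ∀ (l : Fin n) (i : Fin 4), fderiv ℝ (fun y => ((g (‖y - a‖ ^ 2) : ℝ) : ℂ) • G y) q
      (EuclideanSpace.single (l, i) (1 : ℝ)) =
      ((g (‖q - a‖ ^ 2) : ℝ) : ℂ) • fderiv ℝ G q (EuclideanSpace.single (l, i) (1 : ℝ)) +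
      ((2 * g' : ℂ) * (((q - a) (l, i) : ℝ) : ℂ)) • G q := by
    intro l i
    have hin : (innerSL ℝ (q - a)) (EuclideanSpace.single (l, i) (1 : ℝ)) = (q - a) (l, i) := by
      simp [EuclideanSpace.inner_single_right]
    have hc : ((2 * g' : ℂ) * (((q - a) (l, i) : ℝ) : ℂ)) =
        ((g' * (2 * (q - a) (l, i)) : ℝ) : ℂ) := by
      push_cast
      ring
    simp only [Complex.coe_smul]
    rw [hc, Complex.coe_smul, ← hin]
    refine (congrArg (fun L : H n →L[ℝ] Lam n => L (EuclideanSpace.single (l, i) (1 : ℝ)))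
      hF.fderiv).trans ?_
    simp
  rw [d_eq_symb, d_eq_symb]
  simp only [key, sum_om_mul_symb, Finset.sum_add_distrib, ← Finset.smul_sum]
  rw [← Finset.sum_mul, ← pullback_eq_sum, conjPullback_apply]

theorem d_const (α : Fin 2) (w : Lam n) (q : H n) : d α (fun _ => w) q = 0 := by
  have h0 : ∀ l s, om (toLex (l, s)) * symb s α (fun _ : Fin 4 => (0 : Lam n)) = 0 := by
    intro l s
    fin_cases s <;> fin_cases α <;> simp [symb]
  rw [d_eq_symb]
  simp [h0]

theorem conjPullback_single (s : Fin 2) (l : Fin n) (i : Fin 4) :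
    conjPullback s (EuclideanSpace.single (l, i) (1 : ℝ)) =
      pullbackAt l (conjRow (EuclideanSpace.single (l, i) (1 : ℝ)) l) s := by
  rw [conjPullback_apply, pullback_eq_sum, Finset.sum_eq_single l]
  · intro m _ hm
    have : conjRow (EuclideanSpace.single (l, i) (1 : ℝ)) m = 0 := by
      ext <;> simp [hm]
    rw [this, pullbackAt_zero]
  · simp

theorem hasFDerivAt_conjPullback_mul (s : Fin 2) (a q : H n) (w : Lam n) :
    HasFDerivAt (fun y => conjPullback s (y - a) * w)
      (LinearMap.toContinuousLinearMap
        ((LinearMap.mulRight ℂ w).restrictScalars ℝ ∘ₗ conjPullback s)) q := by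
  have h := (LinearMap.toContinuousLinearMap
    ((LinearMap.mulRight ℂ w).restrictScalars ℝ ∘ₗ conjPullback s)).hasFDerivAt (x := q - a)
  exact h.comp q ((hasFDerivAt_id q).sub_const a)

/-- Each of the four real coordinates of q_l contributes one copy of ω^{2l} ∧ ω^{2l+1}, whence the
4. -/
theorem d_conjPullback_mul (a q : H n) (w : Lam n) :
    d 0 (fun y => conjPullback 1 (y - a) * w) q = (4 : ℂ) • (beta n * w) := by
  rw [d_eq_symb, (hasFDerivAt_conjPullback_mul 1 a q w).fderiv, beta, Finset.sum_mul,
    Finset.smul_sum]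
  refine Finset.sum_congr rfl fun l _ => ?_
  have h1 : om (toLex (l, 1)) * om (toLex (l, 0)) = -(om (toLex (l, 0)) * om (toLex (l, 1))) :=
    mul_comm_of_mem_deg_one (om_mem _) (om_mem _)
  have hx : ∀ i, (LinearMap.toContinuousLinearMap
      ((LinearMap.mulRight ℂ w).restrictScalars ℝ ∘ₗ conjPullback 1))
      (EuclideanSpace.single (l, i) (1 : ℝ)) =
      pullbackAt l (conjRow (EuclideanSpace.single (l, i) (1 : ℝ)) l) 1 * w := by
    intro i
    rw [← conjPullback_single]
    rfl
  simp only [hx]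
  simp [Fin.sum_univ_two, symb, pullbackAt, tau, smul_smul, ← mul_assoc, mul_add, mul_sub,
    h1]
  module

theorem hasDerivAt_neg_inv {t : ℝ} (ht : t ≠ 0) :
    HasDerivAt (fun t : ℝ => -(1 / t)) (1 / t ^ 2) t := by
  have h := (hasDerivAt_inv ht).neg
  simp only [neg_neg] at h
  simp only [one_div]
  exact h

/-- With t = ‖q - a‖², d₁(-1/t) is 2 t⁻² times the conjugate pull-back. Applying d₀, the derivative
-4 t⁻³ of 2 t⁻² produces the θ term, and the factor 4 of `d_conjPullback_mul` the β term. -/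
theorem baston_kernel {a q : H n} (hq : q ≠ a) :
    baston (kernel a) q = ((8 / ‖q - a‖ ^ 6 : ℝ) : ℂ) •
      (((‖q - a‖ ^ 2 : ℝ) : ℂ) • beta n - theta (conjRow (q - a))) := by
  have hne : ∀ y : H n, y ≠ a → ‖y - a‖ ^ 2 ≠ 0 := fun y hy =>
    pow_ne_zero _ (norm_ne_zero_iff.2 (sub_ne_zero.2 hy))
  have h1 : d 1 (fun y => algebraMap ℂ (Lam n) (kernel a y : ℂ)) =ᶠ[𝓝 q]
      fun y => ((2 / (‖y - a‖ ^ 2) ^ 2 : ℝ) : ℂ) • (conjPullback 1 (y - a) * 1) := by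
    filter_upwards [isOpen_ne.mem_nhds hq] with y hy
    have h := d_radial_smul (G := fun _ => (1 : Lam n)) 1 (hasDerivAt_neg_inv (hne y hy))
      (differentiableAt_const _)
    rw [d_const, smul_zero, add_zero] at h
    simp only [Algebra.algebraMap_eq_smul_one, kernel]
    rw [h]
    congr 1
    push_cast
    ring
  have hg : HasDerivAt (fun t : ℝ => 2 / t ^ 2) (-4 / (‖q - a‖ ^ 2) ^ 3) (‖q - a‖ ^ 2) := by
    have h0 := hne q hq
    have h := (hasDerivAt_const (‖q - a‖ ^ 2) (2 : ℝ)).div (hasDerivAt_pow 2 (‖q - a‖ ^ 2))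
      (pow_ne_zero 2 h0)
    refine h.congr_deriv ?_
    push_cast
    field_simp
    ring
  have h2 := d_radial_smul (G := fun y => conjPullback 1 (y - a) * 1) 0 hg
    (hasFDerivAt_conjPullback_mul 1 a q 1).differentiableAt
  rw [baston, d_congr h1, h2, d_conjPullback_mul, mul_one, mul_one, theta, conjPullback_apply,
    conjPullback_apply, smul_sub, smul_smul, smul_smul]
  have h0 : (‖q - a‖ : ℂ) ≠ 0 := by
    exact_mod_cast norm_ne_zero_iff.2 (sub_ne_zero.2 hq)
  have e1 : (2 * ((-4 / (‖q - a‖ ^ 2) ^ 3 : ℝ) : ℂ)) = -((8 / ‖q - a‖ ^ 6 : ℝ) : ℂ) := by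
    push_cast
    field_simp
    norm_num
  have e2 : ((2 / (‖q - a‖ ^ 2) ^ 2 : ℝ) : ℂ) * 4 =
      ((8 / ‖q - a‖ ^ 6 : ℝ) : ℂ) * ((‖q - a‖ ^ 2 : ℝ) : ℂ) := by
    push_cast
    field_simp
    norm_num
  rw [e1, e2, neg_smul, neg_add_eq_sub]

end Calculus

/-! ### Wedge products with positive currents -/

section Current

variable {n : ℕ}

theorem coe_smulForm {k : ℕ} {U Ω : Opens (H n)} (hU : U ≤ Ω) {ψ : H n → Lam n}
    (hψ : IsSmoothForm U k ψ) (φ : 𝓓(U, ℂ)) (q : H n) :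
    (smulForm hU hψ φ q : Lam n) = φ q • ψ q := rfl

/-- A nonnegative test function times a form with strongly positive values is a strongly positive
test form, so positivity of T applies. -/
theorem exists_isMeasureOf_wedge {p : ℕ} {U Ω : Opens (H n)} {T : Current Ω (2 * p)}
    (hT : IsPositiveCurrent T) (hU : U ≤ Ω) {ψ : H n → Lam n} (hψ : IsSmoothForm U (2 * p) ψ)
    (hSP : ∀ q ∈ U, ψ q ∈ SP n p) : ∃ μ, IsMeasureOf (wedge T hU hψ) μ := by
  let S : 𝓓(U, ℂ) →ₗ[ℂ] ℂ :=
    { toFun := wedge T hU hψ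
      map_add' := fun φ χ => by
        rw [wedge, wedge, wedge, ← map_add]
        congr 1
        ext q
        exact add_smul (φ q) (χ q) (ψ q)
      map_smul' := fun c φ => by
        rw [wedge, wedge, RingHom.id_apply, ← map_smul]
        congr 1
        ext q
        exact mul_smul c (φ q) (ψ q) }
  refine exists_isMeasureOf S fun φ hφ => hT _ fun q => ?_
  rw [coe_smulForm, realTest_apply]
  by_cases hq : q ∈ U
  · exact smul_mem_SP (hSP q hq) (hφ q)
  · rw [image_eq_zero_of_notMem_tsupport fun h => hq (φ.tsupport_subset h), Complex.ofReal_zero,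
      zero_smul]
    exact zero_mem_SP p

theorem exists_isMeasureOf_wedgeBeta {p : ℕ} {Ω : Opens (H n)} {T : Current Ω (2 * p)}
    (hT : IsPositiveCurrent T) : ∃ μ, IsMeasureOf (wedgeBeta T) μ :=
  exists_isMeasureOf_wedge hT le_rfl _ fun _ _ => pow_mem_SP beta_mem_SP p

theorem baston_kernel_mem_SP {a q : H n} (hq : q ≠ a) : baston (kernel a) q ∈ SP n 1 := by
  rw [baston_kernel hq, ← sum_normSq_conjRow]
  exact smul_mem_SP (normSq_smul_beta_sub_theta_mem_SP _) (by positivity)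

theorem exists_isMeasureOf_wedgeKernel {p : ℕ} {Ω : Opens (H n)} {T : Current Ω (2 * p)}
    (hT : IsPositiveCurrent T) (a : H n) : ∃ μ, IsMeasureOf (wedgeKernel T a) μ :=
  exists_isMeasureOf_wedge hT _ _ fun _ hq => pow_mem_SP (baston_kernel_mem_SP hq.2) p

/-! ### Radial test functions and the use of closedness. -/

/-- A radial test function. -/
def radialTest {U : Opens (H n)} (a : H n) {f : ℝ → ℝ} (hf : ContDiff ℝ ∞ f) {K : Set (H n)}
    (hK : IsCompact K) (hKU : K ⊆ U) (h : ∀ q ∉ K, f (‖q - a‖ ^ 2) = 0) : 𝓓(U, ℂ) where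
  toFun q := ((f (‖q - a‖ ^ 2) : ℝ) : ℂ)
  contDiff' := Complex.ofRealCLM.contDiff.comp
    (hf.comp ((contDiff_id.sub contDiff_const).norm_sq ℝ))
  hasCompactSupport' := HasCompactSupport.intro hK fun q hq => by rw [h q hq, Complex.ofReal_zero]
  tsupport_subset' := (closure_minimal (fun q hq => by
    by_contra hn
    exact hq (by simp [h q hn])) hK.isClosed).trans hKU

theorem radialTest_apply {U : Opens (H n)} (a : H n) {f : ℝ → ℝ} (hf : ContDiff ℝ ∞ f)
    {K : Set (H n)} (hK : IsCompact K) (hKU : K ⊆ U) (h : ∀ q ∉ K, f (‖q - a‖ ^ 2) = 0) (q : H n) :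
    radialTest a hf hK hKU h q = ((f (‖q - a‖ ^ 2) : ℝ) : ℂ) := rfl

/-- The binomial expansion stops after the linear term in y, because y² = 0. -/
theorem sub_pow_succ_of_commute {A : Type*} [Ring A] {x y : A} (h : Commute y x) (hy : y * y = 0)
    (k : ℕ) : (x - y) ^ (k + 1) = x ^ (k + 1) - ((k + 1 : ℕ) : A) * (y * x ^ k) := by
  induction k with
  | zero => simp
  | succ k ih =>
    have h1 : y * x ^ k * y = 0 := by
      rw [mul_assoc, ← (h.pow_right k).eq, ← mul_assoc, hy, zero_mul]
    rw [pow_succ, ih, sub_mul, mul_sub, mul_sub, mul_assoc _ (y * x ^ k) x,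
      mul_assoc _ (y * x ^ k) y, h1, mul_assoc y, ← pow_succ, ← pow_succ, ← (h.pow_right _).eq]
    push_cast
    noncomm_ring

theorem baston_kernel_pow {a q : H n} (hq : q ≠ a) (k : ℕ) :
    baston (kernel a) q ^ (k + 1) = ((8 / ‖q - a‖ ^ 6 : ℝ) : ℂ) ^ (k + 1) •
      (((‖q - a‖ ^ 2 : ℝ) : ℂ) ^ (k + 1) • beta n ^ (k + 1) -
        (((k + 1 : ℕ) : ℂ) * ((‖q - a‖ ^ 2 : ℝ) : ℂ) ^ k) •
          (theta (conjRow (q - a)) * beta n ^ k)) := by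
  rw [baston_kernel hq, smul_pow, sub_pow_succ_of_commute
    ((commute_theta_beta _).smul_right _) (theta_mul_theta_self _), smul_pow, smul_pow, mul_smul,
    mul_smul_comm, ← nsmul_eq_mul, Nat.cast_smul_eq_nsmul]

theorem contDiff_conjPullback_sub (s : Fin 2) (a : H n) :
    ContDiff ℝ ∞ fun q => conjPullback s (q - a) :=
  (LinearMap.toContinuousLinearMap (conjPullback s)).contDiff.comp (contDiff_id.sub contDiff_const)

/-- The closedness of `T`, tested on `F(‖q-a‖²) d₁‖q-a‖² ∧ β_n^k`, turns `T ∧ (△(-‖q-a‖⁻²))^p`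
into `T ∧ β_n^p` on radial test functions. -/
theorem wedgeKernel_radialTest {k : ℕ} {Ω : Opens (H n)} {T : Current Ω (2 * (k + 1))}
    (hT : IsClosedCurrent T) {a : H n} {F φ G : ℝ → ℝ} (hF : ContDiff ℝ ∞ F)
    (hφ : ContDiff ℝ ∞ φ) (hG : ContDiff ℝ ∞ G)
    (hφF : ∀ t, φ t = t ^ (2 * (k + 1) + 1) * deriv F t / (2 * (k + 1)))
    (hGF : ∀ t, G t = F t + t * deriv F t / (2 * (k + 1)))
    {K L : Set (H n)} (hK : IsCompact K) (hKΩ : K ⊆ Ω) (hL : IsCompact L)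
    (hLΩ : L ⊆ puncture Ω a) (hFK : ∀ q ∉ K, F (‖q - a‖ ^ 2) = 0)
    (hφL : ∀ q ∉ L, φ (‖q - a‖ ^ 2) = 0) (hGK : ∀ q ∉ K, G (‖q - a‖ ^ 2) = 0) :
    wedgeKernel T a (radialTest a hφ hL hLΩ hφL) =
      8 ^ (k + 1) * wedgeBeta T (radialTest a hG hK hKΩ hGK) := by
  -- This is half of F(t) d₁t ∧ β_n^k, where t = ‖q - a‖².
  let E : H n → Lam n := fun q =>
    ((F (‖q - a‖ ^ 2) : ℝ) : ℂ) • (conjPullback 1 (q - a) * beta n ^ k)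
  have hE0 : ∀ q ∉ K, E q = 0 := fun q hq => by
    simp only [E, hFK q hq, Complex.ofReal_zero, zero_smul]
  have hEs : ContDiff ℝ ∞ E := by
    have h1 : ContDiff ℝ ∞ fun q : H n => ((F (‖q - a‖ ^ 2) : ℝ) : ℂ) :=
      Complex.ofRealCLM.contDiff.comp (hF.comp ((contDiff_id.sub contDiff_const).norm_sq ℝ))
    have h2 := contDiffOn_univ.1 (contDiffOn_mul (contDiff_conjPullback_sub 1 a).contDiffOn
      (contDiffOn_const (c := beta n ^ k)))
    exact h1.smul h2
  let η : TestForm Ω (1 + 2 * k) := mkTestForm E hEs (HasCompactSupport.intro hK hE0)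
    ((closure_minimal (fun q hq => by
      by_contra hn
      exact hq (hE0 q hn)) hK.isClosed).trans hKΩ)
    (fun q => (deg n _).smul_mem _ (mul_mem_deg (conjPullback_mem 1 _)
      ((isSmoothForm_beta_pow univ k).2 q trivial)))
  have hj : 1 + 2 * k + 1 = 2 * (k + 1) := by ring
  have hcl : T (dTest 0 hj η) = 0 := neg_eq_zero.1 (hT 0 _ hj η)
  have hdη : ∀ q, (dTest 0 hj η q : Lam n) =
      (2 * deriv F (‖q - a‖ ^ 2) : ℂ) • (theta (conjRow (q - a)) * beta n ^ k) +
        (4 * F (‖q - a‖ ^ 2) : ℂ) • beta n ^ (k + 1) := by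
    intro q
    have h := d_radial_smul (a := a) (q := q) (G := fun y => conjPullback 1 (y - a) * beta n ^ k) 0
      ((hF.differentiable (by simp)) _).hasDerivAt
      (hasFDerivAt_conjPullback_mul 1 a q _).differentiableAt
    rw [d_conjPullback_mul, ← mul_assoc, ← pow_succ', smul_smul, mul_comm _ (4 : ℂ)] at h
    exact h
  -- The factor 8^(k+1) / 4 matches the θ coefficients; the definition of G then balances those of
  -- β_n^(k+1).
  have key : smulForm (puncture_le Ω a)
      (isSmoothForm_baston_pow (puncture Ω a).isOpen (contDiffOn_kernel Ω a) (k + 1))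
      (radialTest a hφ hL hLΩ hφL) =
      (8 ^ (k + 1) : ℂ) • smulForm le_rfl (isSmoothForm_beta_pow (Ω : Set (H n)) (k + 1))
        (radialTest a hG hK hKΩ hGK) - (8 ^ (k + 1) / 4 : ℂ) • dTest 0 hj η := by
    ext q
    change (((φ (‖q - a‖ ^ 2) : ℝ) : ℂ) • baston (kernel a) q ^ (k + 1)) =
      (8 ^ (k + 1) : ℂ) • (((G (‖q - a‖ ^ 2) : ℝ) : ℂ) • beta n ^ (k + 1)) -
        (8 ^ (k + 1) / 4 : ℂ) • (dTest 0 hj η q : Lam n)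
    rw [hdη, hφF, hGF]
    -- At a the value of `baston (kernel a)` is irrelevant, since φ(0) = 0; θ vanishes there and
    -- G(0) = F(0).
    by_cases hq : q = a
    · subst hq
      have : theta (conjRow (q - q)) = 0 := by
        rw [theta, ← conjPullback_apply, sub_self, map_zero, zero_mul]
      rw [this]
      rw [zero_mul, smul_zero, zero_add, sub_self, norm_zero, smul_smul, smul_smul, ← sub_smul]
      have e1 : (((0 : ℝ) ^ 2) ^ (2 * (k + 1) + 1) * deriv F (0 ^ 2) / (2 * (k + 1)) : ℝ) = 0 := by
        simp
      have e2 : (8 ^ (k + 1) * ((F (0 ^ 2) + 0 ^ 2 * deriv F (0 ^ 2) / (2 * (k + 1)) : ℝ) : ℂ) -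
          8 ^ (k + 1) / 4 * (4 * (F (0 ^ 2) : ℝ)) : ℂ) = 0 := by
        push_cast
        ring
      rw [e1, e2, Complex.ofReal_zero, zero_smul, zero_smul]
    · have h0 : (‖q - a‖ : ℂ) ≠ 0 := by
        exact_mod_cast norm_ne_zero_iff.2 (sub_ne_zero.2 hq)
      have hk : ((k : ℂ) + 1) ≠ 0 := Nat.cast_add_one_ne_zero k
      rw [baston_kernel_pow hq]
      simp only [smul_sub, smul_add, smul_smul]
      rw [sub_add_eq_sub_sub_swap, ← sub_smul]
      congr 2
      · push_cast
        rw [div_pow, ← pow_mul, ← pow_mul, ← pow_mul]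
        field_simp
        ring
      · push_cast
        rw [div_pow, ← pow_mul, ← pow_mul, ← pow_mul]
        field_simp
        ring
  rw [wedgeKernel, wedge, key, map_sub, map_smul, map_smul, hcl, smul_zero, sub_zero, smul_eq_mul]
  rfl

end Current

/-! ### The radial transform -/

section Radial

/-- The density `2p φ(t) / t^{2p+1}`. -/
def radialDens (p : ℕ) (φ : ℝ → ℝ) (t : ℝ) : ℝ := 2 * p * φ t / t ^ (2 * p + 1)

/-- The primitive of `2p φ(t) / t^{2p+1}` that vanishes at `s`. -/
def radialPrim (p : ℕ) (s : ℝ) (φ : ℝ → ℝ) (t : ℝ) : ℝ := ∫ τ in s..t, radialDens p φ τ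

/-- The transform `φ(t) / t^{2p} - ∫_t^s 2p φ(τ) / τ^{2p+1} dτ`, which relates the radial parts of
`T ∧ (△(-‖q-a‖⁻²))^p` and `T ∧ β_n^p`. -/
def radialDual (p : ℕ) (s : ℝ) (φ : ℝ → ℝ) (t : ℝ) : ℝ := φ t / t ^ (2 * p) + radialPrim p s φ t

variable {p : ℕ} {s ε : ℝ} {φ : ℝ → ℝ}

/-- The only possible singularity is t = 0, near which φ vanishes and so does the quotient. -/
theorem contDiff_div_pow (hφ : ContDiff ℝ ∞ φ) (hε : 0 < ε) (h0 : ∀ t ≤ ε, φ t = 0) (m : ℕ) :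
    ContDiff ℝ ∞ fun t => φ t / t ^ m := by
  rw [contDiff_iff_contDiffAt]
  intro t
  rcases lt_or_ge t ε with ht | ht
  · have : (fun t => φ t / t ^ m) =ᶠ[𝓝 t] fun _ => 0 := by
      filter_upwards [isOpen_Iio.mem_nhds ht] with y hy
      rw [h0 y (le_of_lt hy), zero_div]
    exact contDiffAt_const.congr_of_eventuallyEq this
  · exact hφ.contDiffAt.div (contDiff_id.pow m).contDiffAt (pow_ne_zero m (hε.trans_le ht).ne')

theorem contDiff_radialDens (hφ : ContDiff ℝ ∞ φ) (hε : 0 < ε) (h0 : ∀ t ≤ ε, φ t = 0) :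
    ContDiff ℝ ∞ (radialDens p φ) :=
  contDiff_div_pow (contDiff_const.mul hφ) hε (fun t ht => by rw [h0 t ht, mul_zero]) _

theorem hasDerivAt_radialPrim (hφ : ContDiff ℝ ∞ φ) (hε : 0 < ε) (h0 : ∀ t ≤ ε, φ t = 0) (t : ℝ) :
    HasDerivAt (radialPrim p s φ) (radialDens p φ t) t :=
  ((contDiff_radialDens hφ hε h0).continuous.integral_hasStrictDerivAt s t).hasDerivAt

theorem contDiff_radialPrim (hφ : ContDiff ℝ ∞ φ) (hε : 0 < ε) (h0 : ∀ t ≤ ε, φ t = 0) :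
    ContDiff ℝ ∞ (radialPrim p s φ) := by
  have hd : deriv (radialPrim p s φ) = radialDens p φ :=
    funext fun t => (hasDerivAt_radialPrim hφ hε h0 t).deriv
  rw [contDiff_infty_iff_deriv, hd]
  exact ⟨fun t => (hasDerivAt_radialPrim hφ hε h0 t).differentiableAt, contDiff_radialDens hφ hε h0⟩

theorem contDiff_radialDual (hφ : ContDiff ℝ ∞ φ) (hε : 0 < ε) (h0 : ∀ t ≤ ε, φ t = 0) :
    ContDiff ℝ ∞ (radialDual p s φ) :=
  (contDiff_div_pow hφ hε h0 _).add (contDiff_radialPrim hφ hε h0)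

theorem radialPrim_eq_zero (h1 : ∀ t, s ≤ t → φ t = 0) {t : ℝ} (ht : s ≤ t) :
    radialPrim p s φ t = 0 := by
  refine intervalIntegral.integral_zero_ae (Eventually.of_forall fun τ hτ => ?_)
  rw [uIoc_of_le ht] at hτ
  rw [radialDens, h1 τ hτ.1.le, mul_zero, zero_div]

theorem radialDual_eq_zero (h1 : ∀ t, s ≤ t → φ t = 0) {t : ℝ} (ht : s ≤ t) :
    radialDual p s φ t = 0 := by
  rw [radialDual, radialPrim_eq_zero h1 ht, h1 t ht, zero_div, add_zero]

theorem integral_pow_inv {m : ℝ} (hm : 0 < m) (hms : m ≤ s) :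
    ∫ τ in m..s, 2 * p / τ ^ (2 * p + 1) = 1 / m ^ (2 * p) - 1 / s ^ (2 * p) := by
  have hpos : ∀ τ ∈ uIcc m s, τ ≠ 0 := fun τ hτ => by
    rw [uIcc_of_le hms] at hτ
    exact (hm.trans_le hτ.1).ne'
  have hd : ∀ τ ∈ uIcc m s,
      HasDerivAt (fun τ : ℝ => -(τ ^ (2 * p))⁻¹) (2 * p / τ ^ (2 * p + 1)) τ := by
    intro τ hτ
    have h0 := hpos τ hτ
    refine ((hasDerivAt_pow (2 * p) τ).inv (pow_ne_zero _ h0)).neg.congr_deriv ?_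
    rcases p with _ | p
    · simp
    · rw [show 2 * (p + 1) - 1 = 2 * p + 1 by omega]
      push_cast
      field_simp
      ring
  have hc : ContinuousOn (fun τ : ℝ => 2 * p / τ ^ (2 * p + 1)) (uIcc m s) :=
    continuousOn_const.div (continuous_id.pow _).continuousOn fun τ hτ => pow_ne_zero _ (hpos τ hτ)
  rw [intervalIntegral.integral_eq_sub_of_hasDerivAt hd hc.intervalIntegrable, one_div, one_div]
  ring

theorem norm_div_pow_le (hε : 0 < ε) (h0 : ∀ t ≤ ε, φ t = 0) (hφ : ∀ t, |φ t| ≤ 1) (m : ℕ) (t : ℝ) :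
    |φ t / t ^ m| ≤ 1 / ε ^ m := by
  rcases le_or_gt t ε with ht | ht
  · rw [h0 t ht, zero_div, abs_zero]
    positivity
  · rw [abs_div, abs_of_pos (pow_pos (hε.trans ht) m)]
    exact div_le_div₀ zero_le_one (hφ t) (pow_pos hε m) (pow_le_pow_left₀ hε.le ht.le m)

theorem norm_radialDens_le (hε : 0 < ε) (h0 : ∀ t ≤ ε, φ t = 0) (hφ : ∀ t, |φ t| ≤ 1) (t : ℝ) :
    |radialDens p φ t| ≤ 2 * p * (1 / ε ^ (2 * p + 1)) := by
  rw [radialDens, mul_div_assoc, abs_mul, abs_of_nonneg (by positivity : (0 : ℝ) ≤ 2 * p)]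
  exact mul_le_mul_of_nonneg_left (norm_div_pow_le hε h0 hφ _ t) (by positivity)

/-- The bound depends on φ only through ε and s, so it dominates a whole approximating sequence; it
is integrable because it lives on a relatively compact ball. -/
theorem norm_radialDual_le (hε : 0 < ε) (h0 : ∀ t ≤ ε, φ t = 0) (hφ : ∀ t, |φ t| ≤ 1)
    (h1 : ∀ t, s ≤ t → φ t = 0) {t : ℝ} (ht : 0 ≤ t) :
    |radialDual p s φ t| ≤
      (Iio s).indicator (fun _ => 1 / ε ^ (2 * p) + 2 * p * (1 / ε ^ (2 * p + 1)) * s) t := by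
  rcases lt_or_ge t s with hts | hts
  · rw [indicator_of_mem (mem_Iio.2 hts)]
    have h2 : ‖radialPrim p s φ t‖ ≤ 2 * p * (1 / ε ^ (2 * p + 1)) * |t - s| :=
      intervalIntegral.norm_integral_le_of_norm_le_const fun τ _ => norm_radialDens_le hε h0 hφ τ
    have h3 : |t - s| ≤ s := by
      rw [abs_le]
      constructor <;> linarith
    refine (abs_add_le _ _).trans (add_le_add (norm_div_pow_le hε h0 hφ _ t) (h2.trans ?_))
    exact mul_le_mul_of_nonneg_left h3 (by positivity)
  · rw [radialDual_eq_zero h1 hts, abs_zero, indicator_of_notMem (by simpa using hts)]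

/-- The transform of the indicator function of the interval `E` from `s₁` to `s`. -/
theorem tendsto_radialDual {s₁ : ℝ} {E : Set ℝ} {f : ℕ → ℝ → ℝ} (hs₁ : 0 < s₁) (hs : s₁ < s)
    (hE : Ioo s₁ s ⊆ E) (hE' : E ⊆ Ico s₁ s) (hε : 0 < ε)
    (hf : ∀ j, ContDiff ℝ ∞ (f j)) (h0 : ∀ j, ∀ t ≤ ε, f j t = 0) (hf1 : ∀ j t, |f j t| ≤ 1)
    (h1 : ∀ j t, s ≤ t → f j t = 0)
    (hlim : ∀ t, Tendsto (fun j => f j t) atTop (𝓝 (E.indicator 1 t))) (t : ℝ) :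
    Tendsto (fun j => radialDual p s (f j) t) atTop
      (𝓝 ((Iio s).indicator (fun _ => 1 / s ^ (2 * p)) t -
        (Iio s \ E).indicator (fun _ => 1 / s₁ ^ (2 * p)) t)) := by
  rcases lt_or_ge t s with hts | hts
  · have hprim : Tendsto (fun j => radialPrim p s (f j) t) atTop
        (𝓝 (-(1 / (max t s₁) ^ (2 * p) - 1 / s ^ (2 * p)))) := by
      have hdct : Tendsto (fun j => ∫ τ in t..s, radialDens p (f j) τ) atTop
          (𝓝 (∫ τ in t..s, radialDens p (E.indicator 1) τ)) := by
        refine intervalIntegral.tendsto_integral_filter_of_dominated_convergence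
          (fun _ => 2 * p * (1 / ε ^ (2 * p + 1))) (Eventually.of_forall fun j =>
            (contDiff_radialDens (hf j) hε (h0 j)).continuous.aestronglyMeasurable)
          (Eventually.of_forall fun j => Eventually.of_forall fun τ _ =>
            norm_radialDens_le hε (h0 j) (hf1 j) τ) intervalIntegrable_const
          (Eventually.of_forall fun τ _ => ((hlim τ).const_mul _).div_const _)
      have heq : ∫ τ in t..s, radialDens p (E.indicator 1) τ =
          1 / (max t s₁) ^ (2 * p) - 1 / s ^ (2 * p) := by
        have hm : max t s₁ ≤ s := max_le hts.le hs.le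
        rw [← integral_pow_inv (lt_max_of_lt_right hs₁) hm,
          intervalIntegral.integral_of_le hts.le, intervalIntegral.integral_of_le hm,
          ← integral_indicator measurableSet_Ioc, ← integral_indicator measurableSet_Ioc]
        refine integral_congr_ae ?_
        -- The endpoints are Lebesgue null, so the primitive does not see whether s₁ belongs to E.
        -- That choice enters only through the term φ(t) / t^{2p}.
        filter_upwards [compl_mem_ae_iff.2 (measure_singleton s₁),
          compl_mem_ae_iff.2 (measure_singleton s)] with τ hτ₁ hτ
        by_cases hτE : τ ∈ Ioo s₁ s
        · by_cases htτ : t < τ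
          · rw [indicator_of_mem (mem_Ioc.2 ⟨htτ, hτE.2.le⟩),
              indicator_of_mem (mem_Ioc.2 ⟨max_lt htτ hτE.1, hτE.2.le⟩), radialDens,
              indicator_of_mem (hE hτE), Pi.one_apply, mul_one]
          · rw [indicator_of_notMem fun h => htτ h.1,
              indicator_of_notMem fun h => htτ ((le_max_left _ _).trans_lt h.1)]
        · have hn : τ ∉ E := fun h => hτE ⟨lt_of_le_of_ne (hE' h).1 (Ne.symm hτ₁), (hE' h).2⟩
          have hn' : τ ∉ Ioc (max t s₁) s := fun h =>
            hτE ⟨(le_max_right _ _).trans_lt h.1, lt_of_le_of_ne h.2 hτ⟩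
          rw [indicator_of_notMem hn', indicator_apply]
          split_ifs
          · rw [radialDens, indicator_of_notMem hn, mul_zero, zero_div]
          · rfl
      rw [heq] at hdct
      simpa only [radialPrim, intervalIntegral.integral_symm t s] using hdct.neg
    have hsum := ((hlim t).div_const (t ^ (2 * p))).add hprim
    change Tendsto (fun j => f j t / t ^ (2 * p) + radialPrim p s (f j) t) atTop _
    convert hsum using 2
    rw [indicator_of_mem (mem_Iio.2 hts)]
    -- On E the term 1/t^{2p} cancels against the primitive and leaves 1/s^{2p}; below E only the
    -- constant value of the primitive remains.
    by_cases htE : t ∈ E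
    · rw [indicator_of_notMem fun h => h.2 htE, indicator_of_mem htE, max_eq_left (hE' htE).1,
        Pi.one_apply]
      ring
    · have hle : t ≤ s₁ := not_lt.1 fun h => htE (hE ⟨h, hts⟩)
      rw [indicator_of_mem (show t ∈ Iio s \ E from ⟨hts, htE⟩), indicator_of_notMem htE,
        max_eq_right hle]
      ring
  · have : ∀ j, radialDual p s (f j) t = 0 := fun j => radialDual_eq_zero (h1 j) hts
    simp only [this]
    rw [indicator_of_notMem (by simpa using hts), indicator_of_notMem fun h => not_lt.2 hts h.1,
      sub_zero]
    exact tendsto_const_nhds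

/-- The indicator functions of `[s₁, s)` and `(s₁, s)` are limits of smooth functions with values
in `[0, 1]` and supports in `[s₁ / 2, s]`. -/
theorem exists_seq_tendsto_indicator {s₁ : ℝ} {E : Set ℝ} (hs₁ : 0 < s₁)
    (hE : E = Ico s₁ s ∨ E = Ioo s₁ s) :
    ∃ f : ℕ → ℝ → ℝ, (∀ j, ContDiff ℝ ∞ (f j)) ∧ (∀ j, ∀ t ≤ s₁ / 2, f j t = 0) ∧
      (∀ j t, |f j t| ≤ 1) ∧ (∀ j t, s ≤ t → f j t = 0) ∧
      ∀ t, Tendsto (fun j => f j t) atTop (𝓝 (E.indicator 1 t)) := by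
  -- The argument of the left transition equals c at t = s₁ for all j, so c = 1 puts s₁ into the
  -- limit set and c = 0 leaves it out.
  obtain ⟨c, hc0, hc1, hc⟩ : ∃ c : ℝ, 0 ≤ c ∧ c ≤ 1 ∧
      ∀ t, E.indicator (1 : ℝ → ℝ) t = (if t < s₁ then 0 else if t = s₁ then
        Real.smoothTransition c else 1) * (if t < s then 1 else 0) := by
    rcases hE with rfl | rfl
    · refine ⟨1, zero_le_one, le_rfl, fun t => ?_⟩
      rw [Real.smoothTransition.one]
      simp only [indicator_apply, mem_Ico, Pi.one_apply]
      grind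
    · refine ⟨0, le_rfl, zero_le_one, fun t => ?_⟩
      rw [Real.smoothTransition.zero]
      simp only [indicator_apply, mem_Ioo, Pi.one_apply]
      grind
  -- A slope of at least 2 / s₁ makes the left argument at most c - 1 ≤ 0 for all t ≤ s₁ / 2,
  -- uniformly in j.
  have hN : ∀ j : ℕ, 0 ≤ (j : ℝ) + 2 / s₁ := fun j => by positivity
  have htop : Tendsto (fun j : ℕ => (j : ℝ) + 2 / s₁) atTop atTop :=
    tendsto_atTop_add_const_right _ _ tendsto_natCast_atTop_atTop
  refine ⟨fun j t => Real.smoothTransition (((j : ℝ) + 2 / s₁) * (t - s₁) + c) *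
    Real.smoothTransition (((j : ℝ) + 2 / s₁) * (s - t)), fun j => ?_, fun j t ht => ?_,
    fun j t => ?_, fun j t ht => ?_, fun t => ?_⟩
  · have hS : ContDiff ℝ ∞ Real.smoothTransition := Real.smoothTransition.contDiff (n := ⊤)
    exact (hS.comp (by fun_prop)).mul (hS.comp (by fun_prop))
  · have h2 : 2 / s₁ * (t - s₁) ≤ -1 := by
      rw [div_mul_eq_mul_div, div_le_iff₀ hs₁]
      linarith
    have h3 : (j : ℝ) * (t - s₁) ≤ 0 := mul_nonpos_of_nonneg_of_nonpos (by positivity) (by linarith)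
    have h4 : ((j : ℝ) + 2 / s₁) * (t - s₁) + c ≤ 0 := by
      rw [add_mul]
      linarith
    simp only [Real.smoothTransition.zero_of_nonpos h4, zero_mul]
  · rw [abs_of_nonneg
      (mul_nonneg (Real.smoothTransition.nonneg _) (Real.smoothTransition.nonneg _))]
    exact mul_le_one₀ (Real.smoothTransition.le_one _) (Real.smoothTransition.nonneg _)
      (Real.smoothTransition.le_one _)
  · have h4 : ((j : ℝ) + 2 / s₁) * (s - t) ≤ 0 :=
      mul_nonpos_of_nonneg_of_nonpos (hN j) (by linarith)
    simp only [Real.smoothTransition.zero_of_nonpos h4, mul_zero]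
  · rw [hc t]
    refine Tendsto.mul ?_ ?_
    · split_ifs with h h'
      · refine tendsto_const_nhds.congr' ?_
        filter_upwards [(htop.atTop_mul_const_of_neg (sub_neg.2 h)).eventually_le_atBot (-c)]
          with j hj
        rw [Real.smoothTransition.zero_of_nonpos (by linarith)]
      · subst h'
        simp
      · have hlt : 0 < t - s₁ := sub_pos.2 (lt_of_le_of_ne (not_lt.1 h) (Ne.symm h'))
        refine tendsto_const_nhds.congr' ?_
        filter_upwards [(htop.atTop_mul_const hlt).eventually_ge_atTop 1] with j hj
        rw [Real.smoothTransition.one_of_one_le (by linarith)]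
    · split_ifs with h
      · refine tendsto_const_nhds.congr' ?_
        filter_upwards [(htop.atTop_mul_const (sub_pos.2 h)).eventually_ge_atTop 1] with j hj
        rw [Real.smoothTransition.one_of_one_le hj]
      · refine tendsto_const_nhds.congr fun j => ?_
        rw [Real.smoothTransition.zero_of_nonpos
          (mul_nonpos_of_nonneg_of_nonpos (hN j) (by linarith))]

end Radial

/-! ### The mass of shells -/

section Shell

variable {n p : ℕ} {Ω : Opens (H n)} {T : Current Ω (2 * p)} {a : H n} {r : ℝ}

theorem isCompact_shell (a : H n) (r ε : ℝ) :
    IsCompact (closedBall a r ∩ {q | ε ≤ ‖q - a‖ ^ 2}) :=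
  (isCompact_closedBall a r).inter_right
    (isClosed_le continuous_const ((continuous_id.sub continuous_const).norm.pow 2))

theorem shell_subset_puncture (hr : closedBall a r ⊆ Ω) {ε : ℝ} (hε : 0 < ε) :
    closedBall a r ∩ {q | ε ≤ ‖q - a‖ ^ 2} ⊆ puncture Ω a := by
  rintro q ⟨hq, hq'⟩
  refine ⟨hr hq, fun h => ?_⟩
  have h0 : q = a := h
  rw [mem_ofPred_eq, h0, sub_self, norm_zero] at hq'
  norm_num at hq'
  linarith

theorem sq_le_of_notMem_closedBall (hr : 0 ≤ r) {q : H n} (hq : q ∉ closedBall a r) :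
    r ^ 2 ≤ ‖q - a‖ ^ 2 := by
  rw [mem_closedBall, dist_eq_norm, not_le] at hq
  exact pow_le_pow_left₀ hr hq.le 2

/-- For p ≥ 1 this is `wedgeKernel_radialTest` with F = `radialPrim` and G = `radialDual`. Near 0
the function F is constant but in general not zero, so the form tested against T lives on the whole
ball, across a. -/
theorem integral_radial_eq (hT : IsClosedCurrent T) {μ κ : Measure (H n)}
    (hμ : IsMeasureOf (wedgeBeta T) μ) (hκ : IsMeasureOf (wedgeKernel T a) κ) (hr0 : 0 ≤ r)
    (hr : closedBall a r ⊆ Ω) {ε : ℝ} (hε : 0 < ε) {φ : ℝ → ℝ} (hφ : ContDiff ℝ ∞ φ)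
    (h0 : ∀ t ≤ ε, φ t = 0) (h1 : ∀ t, r ^ 2 ≤ t → φ t = 0) :
    ∫ q, φ (‖q - a‖ ^ 2) ∂κ = 8 ^ p * ∫ q, radialDual p (r ^ 2) φ (‖q - a‖ ^ 2) ∂μ := by
  have hφL : ∀ q ∉ closedBall a r ∩ {q | ε ≤ ‖q - a‖ ^ 2}, φ (‖q - a‖ ^ 2) = 0 := by
    intro q hq
    by_cases hqr : q ∈ closedBall a r
    · exact h0 _ (le_of_lt (not_le.1 fun h => hq ⟨hqr, h⟩))
    · exact h1 _ (sq_le_of_notMem_closedBall hr0 hqr)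
  have hG := contDiff_radialDual (p := p) (s := r ^ 2) hφ hε h0
  have hGK : ∀ q ∉ closedBall a r, radialDual p (r ^ 2) φ (‖q - a‖ ^ 2) = 0 := fun q hq =>
    radialDual_eq_zero h1 (sq_le_of_notMem_closedBall hr0 hq)
  have key : wedgeKernel T a (radialTest a hφ (isCompact_shell a r ε)
      (shell_subset_puncture hr hε) hφL) =
      8 ^ p * wedgeBeta T (radialTest a hG (isCompact_closedBall a r) hr hGK) := by
    cases p with
    -- There is no form of lower degree to test on, but both currents are T and the primitive
    -- vanishes identically.
    | zero =>
      rw [pow_zero, one_mul]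
      refine congrArg T (TestFunction.ext fun q => Subtype.ext ?_)
      change ((φ (‖q - a‖ ^ 2) : ℝ) : ℂ) • baston (kernel a) q ^ 0 =
        ((radialDual 0 (r ^ 2) φ (‖q - a‖ ^ 2) : ℝ) : ℂ) • beta n ^ 0
      have : radialDual 0 (r ^ 2) φ (‖q - a‖ ^ 2) = φ (‖q - a‖ ^ 2) := by
        simp [radialDual, radialPrim, radialDens]
      rw [this, pow_zero, pow_zero]
    | succ k =>
      have hd : ∀ t, deriv (radialPrim (k + 1) (r ^ 2) φ) t = radialDens (k + 1) φ t := fun t =>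
        (hasDerivAt_radialPrim hφ hε h0 t).deriv
      have hk : (k : ℝ) + 1 ≠ 0 := by positivity
      refine wedgeKernel_radialTest hT (contDiff_radialPrim (p := k + 1) hφ hε h0) hφ hG ?_ ?_
        _ _ _ _
        (fun q hq => radialPrim_eq_zero h1 (sq_le_of_notMem_closedBall hr0 hq)) _ _
      · intro t
        rw [hd, radialDens]
        by_cases ht : t = 0
        · rw [ht, h0 0 hε.le]
          simp
        · push_cast
          field_simp
      · intro t
        rw [hd, radialDens, radialDual, add_comm]
        by_cases ht : t = 0
        · rw [ht, h0 0 hε.le]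
          simp
        · congr 1
          push_cast
          field_simp
          ring
  rw [hκ.2.2, hμ.2.2] at key
  simp only [radialTest_apply, integral_complex_ofReal] at key
  exact_mod_cast key

/-- Apply `integral_radial_eq` to smooth approximations of the indicator function of E and pass to
the limit on both sides. -/
theorem measureReal_shell (hT : IsClosedCurrent T) {μ κ : Measure (H n)}
    (hμ : IsMeasureOf (wedgeBeta T) μ) (hκ : IsMeasureOf (wedgeKernel T a) κ) (hr0 : 0 ≤ r)
    (hr : closedBall a r ⊆ Ω) {s₁ : ℝ} (hs₁ : 0 < s₁) (hs : s₁ < r ^ 2) {E : Set ℝ}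
    (hE : E = Ico s₁ (r ^ 2) ∨ E = Ioo s₁ (r ^ 2)) :
    κ.real ((fun q => ‖q - a‖ ^ 2) ⁻¹' E) =
      8 ^ p * (μ.real ((fun q => ‖q - a‖ ^ 2) ⁻¹' Iio (r ^ 2)) / (r ^ 2) ^ (2 * p) -
        μ.real ((fun q => ‖q - a‖ ^ 2) ⁻¹' (Iio (r ^ 2) \ E)) / s₁ ^ (2 * p)) := by
  set u : H n → ℝ := fun q => ‖q - a‖ ^ 2 with hu
  have huc : Continuous u := (continuous_id.sub continuous_const).norm.pow 2
  have hEm : MeasurableSet E := by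
    rcases hE with rfl | rfl
    · exact measurableSet_Ico
    · exact measurableSet_Ioo
  have hE1 : Ioo s₁ (r ^ 2) ⊆ E := by
    rcases hE with rfl | rfl
    · exact Ioo_subset_Ico_self
    · exact subset_rfl
  have hE2 : E ⊆ Ico s₁ (r ^ 2) := by
    rcases hE with rfl | rfl
    · exact subset_rfl
    · exact Ioo_subset_Ico_self
  have hball : ∀ q, u q ≤ r ^ 2 → q ∈ closedBall a r := fun q hq => by
    rw [mem_closedBall, dist_eq_norm]
    exact (pow_le_pow_iff_left₀ (norm_nonneg _) hr0 two_ne_zero).1 hq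
  obtain ⟨f, hf, h0, hf1, h1, hlim⟩ := exists_seq_tendsto_indicator hs₁ hE
  have hε : 0 < s₁ / 2 := half_pos hs₁
  have hκK : κ (closedBall a r ∩ {q | s₁ / 2 ≤ u q}) < ⊤ :=
    hκ.2.1 _ (isCompact_shell a r _) (shell_subset_puncture hr hε)
  have hκm : MeasurableSet (closedBall a r ∩ {q | s₁ / 2 ≤ u q}) :=
    (isCompact_shell a r _).isClosed.measurableSet
  have hμK : μ (closedBall a r) < ⊤ := hμ.2.1 _ (isCompact_closedBall a r) hr
  have hμI : μ (u ⁻¹' Iio (r ^ 2)) < ⊤ :=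
    (measure_mono fun q hq => hball q (le_of_lt hq)).trans_lt hμK
  have hμE : μ (u ⁻¹' (Iio (r ^ 2) \ E)) < ⊤ :=
    (measure_mono (preimage_mono sdiff_subset)).trans_lt hμI
  have hmI : MeasurableSet (u ⁻¹' Iio (r ^ 2)) := huc.measurable measurableSet_Iio
  have hmE : MeasurableSet (u ⁻¹' (Iio (r ^ 2) \ E)) :=
    huc.measurable (measurableSet_Iio.diff hEm)
  have hleft : Tendsto (fun j => ∫ q, f j (u q) ∂κ) atTop (𝓝 (κ.real (u ⁻¹' E))) := by
    have hval : ∫ q, E.indicator (1 : ℝ → ℝ) (u q) ∂κ = κ.real (u ⁻¹' E) := by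
      rw [← integral_indicator_one (huc.measurable hEm)]
      rfl
    rw [← hval]
    -- κ is known to be finite only on compact sets avoiding a, so the majorant must be supported
    -- away from a; this uses that all `f j` vanish up to s₁ / 2.
    refine tendsto_integral_of_dominated_convergence
      ((closedBall a r ∩ {q | s₁ / 2 ≤ u q}).indicator 1)
      (fun j => ((hf j).continuous.comp huc).aestronglyMeasurable) ?_
      (fun j => Eventually.of_forall fun q => ?_) (Eventually.of_forall fun q => hlim (u q))
    · exact (integrable_indicator_iff hκm).2 (integrableOn_const hκK.ne)
    · by_cases hq : q ∈ closedBall a r ∩ {q | s₁ / 2 ≤ u q}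
      · rw [indicator_of_mem hq]
        exact hf1 j _
      · rw [indicator_of_notMem hq]
        by_cases hqr : q ∈ closedBall a r
        · rw [h0 j _ (le_of_lt (not_le.1 fun h => hq ⟨hqr, h⟩)), norm_zero]
        · rw [h1 j _ (sq_le_of_notMem_closedBall hr0 hqr), norm_zero]
  have hright : Tendsto (fun j => ∫ q, radialDual p (r ^ 2) (f j) (u q) ∂μ) atTop
      (𝓝 (μ.real (u ⁻¹' Iio (r ^ 2)) / (r ^ 2) ^ (2 * p) -
        μ.real (u ⁻¹' (Iio (r ^ 2) \ E)) / s₁ ^ (2 * p))) := by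
    have hval : ∫ q, ((Iio (r ^ 2)).indicator (fun _ => 1 / (r ^ 2) ^ (2 * p)) (u q) -
        (Iio (r ^ 2) \ E).indicator (fun _ => 1 / s₁ ^ (2 * p)) (u q)) ∂μ =
        μ.real (u ⁻¹' Iio (r ^ 2)) / (r ^ 2) ^ (2 * p) -
          μ.real (u ⁻¹' (Iio (r ^ 2) \ E)) / s₁ ^ (2 * p) := by
      have e1 := integral_indicator_const (μ := μ) (1 / (r ^ 2) ^ (2 * p)) hmI
      have e2 := integral_indicator_const (μ := μ) (1 / s₁ ^ (2 * p)) hmE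
      rw [smul_eq_mul, mul_one_div] at e1 e2
      rw [← e1, ← e2]
      exact integral_sub ((integrable_indicator_iff hmI).2 (integrableOn_const hμI.ne))
        ((integrable_indicator_iff hmE).2 (integrableOn_const hμE.ne))
    rw [← hval]
    refine tendsto_integral_of_dominated_convergence
      (fun q => (Iio (r ^ 2)).indicator (fun _ => 1 / (s₁ / 2) ^ (2 * p) +
        2 * p * (1 / (s₁ / 2) ^ (2 * p + 1)) * r ^ 2) (u q))
      (fun j => ((contDiff_radialDual (hf j) hε (h0 j)).continuous.comp huc).aestronglyMeasurable)
      ?_ (fun j => Eventually.of_forall fun q =>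
        norm_radialDual_le hε (h0 j) (hf1 j) (h1 j) (by positivity))
      (Eventually.of_forall fun q => tendsto_radialDual hs₁ hs hE1 hE2 hε hf h0 hf1 h1 hlim (u q))
    exact (integrable_indicator_iff hmI).2 (integrableOn_const hμI.ne)
  refine tendsto_nhds_unique hleft ((hright.const_mul (8 ^ p)).congr fun j => ?_)
  exact (integral_radial_eq hT hμ hκ hr0 hr hε (hf j) (h0 j) (h1 j)).symm

/-- The shell identity holds for every pair of representing measures, so the one chosen here may be
arbitrary. -/
theorem isMeasureOf_measureOf {U : Opens (H n)} {S : 𝓓(U, ℂ) → ℂ} (h : ∃ μ, IsMeasureOf S μ) :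
    IsMeasureOf S (measureOf S) := by
  rw [measureOf, dif_pos h]
  exact h.choose_spec

theorem preimage_Iio_sq (a : H n) (hr : 0 ≤ r) :
    (fun q : H n => ‖q - a‖ ^ 2) ⁻¹' Iio (r ^ 2) = ball a r := by
  ext q
  rw [mem_ball, dist_eq_norm]
  exact pow_lt_pow_iff_left₀ (norm_nonneg _) hr two_ne_zero

theorem preimage_Iic_sq (a : H n) (hr : 0 ≤ r) :
    (fun q : H n => ‖q - a‖ ^ 2) ⁻¹' Iic (r ^ 2) = closedBall a r := by
  ext q
  rw [mem_closedBall, dist_eq_norm]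
  exact pow_le_pow_iff_left₀ (norm_nonneg _) hr two_ne_zero

/-! ### The shell formulas, monotonicity and the Lelong number. -/

variable {R r₁ r₂ : ℝ}

/-- Here E is the half-open interval: the shell contains its inner sphere, so the open ball of
radius r₁ is left over. -/
theorem integralOn_wedgeKernel_diff_ball (hpos : IsPositiveCurrent T) (hT : IsClosedCurrent T)
    (hr₂ : closedBall a r₂ ⊆ Ω) (h₁ : 0 < r₁) (h₁₂ : r₁ < r₂) :
    integralOn (wedgeKernel T a) (ball a r₂ \ ball a r₁) =
      8 ^ p * (sigma T a r₂ / r₂ ^ (4 * p) - sigma T a r₁ / r₁ ^ (4 * p)) := by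
  have h₂ : 0 ≤ r₂ := (h₁.trans h₁₂).le
  have hsq : r₁ ^ 2 < r₂ ^ 2 := pow_lt_pow_left₀ h₁₂ h₁.le two_ne_zero
  have h := measureReal_shell hT (isMeasureOf_measureOf (exists_isMeasureOf_wedgeBeta hpos))
    (isMeasureOf_measureOf (exists_isMeasureOf_wedgeKernel hpos a)) h₂ hr₂ (pow_pos h₁ 2) hsq
    (Or.inl rfl)
  have e1 : Ico (r₁ ^ 2) (r₂ ^ 2) = Iio (r₂ ^ 2) \ Iio (r₁ ^ 2) := by
    rw [← Ici_inter_Iio, sdiff_eq, compl_Iio, inter_comm]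
  have e2 : Iio (r₂ ^ 2) \ Ico (r₁ ^ 2) (r₂ ^ 2) = Iio (r₁ ^ 2) := by
    rw [e1, sdiff_sdiff_cancel_left (Iio_subset_Iio hsq.le)]
  rw [e2, e1, preimage_sdiff, preimage_Iio_sq a h₂, preimage_Iio_sq a h₁.le, ← pow_mul, ← pow_mul,
    show 2 * (2 * p) = 4 * p by ring] at h
  exact h

/-- With E open, the inner sphere passes to the remaining ball, which becomes closed. -/
theorem integralOn_wedgeKernel_diff_closedBall (hpos : IsPositiveCurrent T)
    (hT : IsClosedCurrent T) (hr₂ : closedBall a r₂ ⊆ Ω) (h₁ : 0 < r₁) (h₁₂ : r₁ < r₂) :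
    integralOn (wedgeKernel T a) (ball a r₂ \ closedBall a r₁) =
      8 ^ p * (sigma T a r₂ / r₂ ^ (4 * p) -
        integralOn (wedgeBeta T) (closedBall a r₁) / r₁ ^ (4 * p)) := by
  have h₂ : 0 ≤ r₂ := (h₁.trans h₁₂).le
  have hsq : r₁ ^ 2 < r₂ ^ 2 := pow_lt_pow_left₀ h₁₂ h₁.le two_ne_zero
  have h := measureReal_shell hT (isMeasureOf_measureOf (exists_isMeasureOf_wedgeBeta hpos))
    (isMeasureOf_measureOf (exists_isMeasureOf_wedgeKernel hpos a)) h₂ hr₂ (pow_pos h₁ 2) hsq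
    (Or.inr rfl)
  have e1 : Ioo (r₁ ^ 2) (r₂ ^ 2) = Iio (r₂ ^ 2) \ Iic (r₁ ^ 2) := by
    rw [← Ioi_inter_Iio, sdiff_eq, compl_Iic, inter_comm]
  have e2 : Iio (r₂ ^ 2) \ Ioo (r₁ ^ 2) (r₂ ^ 2) = Iic (r₁ ^ 2) := by
    rw [e1, sdiff_sdiff_cancel_left (Iic_subset_Iio.2 hsq)]
  rw [e2, e1, preimage_sdiff, preimage_Iio_sq a h₂, preimage_Iic_sq a h₁.le, ← pow_mul, ← pow_mul,
    show 2 * (2 * p) = 4 * p by ring] at h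
  exact h

theorem monotoneOn_sigma_div (hpos : IsPositiveCurrent T) (hT : IsClosedCurrent T)
    (hR : closure (ball a R) ⊆ Ω) :
    MonotoneOn (fun r : ℝ => sigma T a r / r ^ (4 * p)) (Ioo 0 R) := by
  intro r₁ h₁ r₂ h₂ hle
  rcases hle.eq_or_lt with rfl | hlt
  · exact le_rfl
  · have h := integralOn_wedgeKernel_diff_ball hpos hT
      (((closedBall_subset_ball h₂.2).trans subset_closure).trans hR) h₁.1 hlt
    have h0 : 0 ≤ integralOn (wedgeKernel T a) (ball a r₂ \ ball a r₁) := measureReal_nonneg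
    rw [h] at h0
    exact sub_nonneg.1 (nonneg_of_mul_nonneg_right h0 (by positivity))

theorem exists_isLelongNumber (hpos : IsPositiveCurrent T) (hT : IsClosedCurrent T) (hR0 : 0 < R)
    (hR : closure (ball a R) ⊆ Ω) : ∃ ν : ℝ, IsLelongNumber T a ν ∧ 0 ≤ ν := by
  have h0 : ∀ r ∈ Ioo 0 R, 0 ≤ sigma T a r / r ^ (4 * p) := fun r hr =>
    div_nonneg measureReal_nonneg (pow_nonneg hr.1.le _)
  have hlim := (monotoneOn_sigma_div hpos hT hR).tendsto_nhdsWithin_Ioo_right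
    (nonempty_Ioo.2 hR0) ⟨0, by rintro _ ⟨r, hr, rfl⟩; exact h0 r hr⟩
  refine ⟨_, hlim, ge_of_tendsto hlim ?_⟩
  filter_upwards [Ioo_mem_nhdsGT hR0] with r hr using h0 r hr

end Shell

end QCurrent

end

theorem proposition4p3 {n p : ℕ} (hp : p ≤ n) (Ω : TopologicalSpace.Opens (QCurrent.H n))
    (a : QCurrent.H n) (R : ℝ) (hR : 0 < R) (hball : closure (ball a R) ⊆ (Ω : Set (QCurrent.H n)))
    (T : QCurrent.Current Ω (2 * p)) (hpos : QCurrent.IsPositiveCurrent T)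
    (hclosed : QCurrent.IsClosedCurrent T) :
    -- both `2n`-currents are given by positive Radon measures, so that the integrals make sense
    (∃ μ, QCurrent.IsMeasureOf (QCurrent.wedgeBeta T) μ) ∧
    (∃ μ, QCurrent.IsMeasureOf (QCurrent.wedgeKernel T a) μ) ∧
    -- the formula on the shells `r₁ ≤ ‖q - a‖ < r₂`
    (∀ r₁ r₂ : ℝ, 0 < r₁ → r₁ < r₂ → r₂ < R →
      QCurrent.integralOn (QCurrent.wedgeKernel T a) (ball a r₂ \ ball a r₁) =
        8 ^ p * (QCurrent.sigma T a r₂ / r₂ ^ (4 * p) - QCurrent.sigma T a r₁ / r₁ ^ (4 * p))) ∧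
    -- the formula on the shells `r₁ < ‖q - a‖ < r₂`
    (∀ r₁ r₂ : ℝ, 0 < r₁ → r₁ < r₂ → r₂ < R →
      QCurrent.integralOn (QCurrent.wedgeKernel T a) (ball a r₂ \ closedBall a r₁) =
        8 ^ p * (QCurrent.sigma T a r₂ / r₂ ^ (4 * p) -
          QCurrent.integralOn (QCurrent.wedgeBeta T) (closedBall a r₁) / r₁ ^ (4 * p))) ∧
    -- `r^{-4p} σ_T(a, r)` is increasing
    MonotoneOn (fun r : ℝ => QCurrent.sigma T a r / r ^ (4 * p)) (Ioo 0 R) ∧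
    -- the Lelong number exists and is nonnegative
    ∃ ν : ℝ, QCurrent.IsLelongNumber T a ν ∧ 0 ≤ ν := by
  have hcl : ∀ r < R, closedBall a r ⊆ Ω := fun r hr =>
    ((closedBall_subset_ball hr).trans subset_closure).trans hball
  exact ⟨QCurrent.exists_isMeasureOf_wedgeBeta hpos,
    QCurrent.exists_isMeasureOf_wedgeKernel hpos a,
    fun r₁ r₂ h₁ h₁₂ h₂ =>
      QCurrent.integralOn_wedgeKernel_diff_ball hpos hclosed (hcl r₂ h₂) h₁ h₁₂,
    fun r₁ r₂ h₁ h₁₂ h₂ =>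
      QCurrent.integralOn_wedgeKernel_diff_closedBall hpos hclosed (hcl r₂ h₂) h₁ h₁₂,
    QCurrent.monotoneOn_sigma_div hpos hclosed hball,
    QCurrent.exists_isLelongNumber hpos hclosed hR hball⟩
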